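/- Let $\|\cdot\|$ be a norm on $\mathbb{R}^3$ that is smooth away from the origin and strictly convex, and whose unit sphere $\partial B=\{x:\|x\|=1\}$ has nowhere vanishing (usual) Gaussian curvature. Let $M\subset\mathbb{R}^3$ be a non-empty compact smooth embedded surface without boundary, and let $\eta:M\to\partial B$ be a Birkhoff--Gauss map of $M$, that is, a continuous map such that $\eta(p)$ is Birkhoff orthogonal to the tangent plane $T_pM$ for every $p\in M$: $\|\eta(p)\|\le\|\eta(p)+tw\|$ for all $w\in T_pM$ and $t\in\mathbb{R}$. Let $K(p)=\det(d\eta_p)$ be the Minkowski Gaussian curvature, where $d\eta_p$ is regarded as an endomorphism of $T_pM$, let $\omega(X,Y)=\det(X,Y,\eta)$ be the induced area element, with $M$ oriented so that $\omega$ is positive, and let $\lambda_M(M)=\int_M\omega$. For $\varepsilon>0$ let $$M_\varepsilon=\{z\in\mathbb{R}^3:\ \inf_{p\in M}\|z-p\|\le\varepsilon\}.$$ Then $\lambda_M(M)$ is finite, $K$ is integrable over $M$ with respect to $\omega$, and there is $\varepsilon_0>0$ such that for every $\varepsilon$ with $0<\varepsilon<\varepsilon_0$ the Lebesgue measure of $M_\varepsilon$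 is finite and $$\mathrm{vol}(M_\varepsilon)=2\varepsilon\,\lambda_M(M)+\frac{2\varepsilon^3}{3}\int_M K\,\omega .$$ -/

import Mathlib

open MeasureTheory Set Topology
open scoped ContDiff

noncomputable section

namespace Minkowski

/-- The space `ℝ³`, with its usual inner product and Lebesgue measure. The Minkowski norm is an
additional datum `N : Seminorm ℝ E3`. -/
abbrev E3 : Type := EuclideanSpace ℝ (Fin 3)

/-- The usual determinant of three vectors of `ℝ³`. -/
def det3 (X Y Z : E3) : ℝ :=
  Matrix.det !![X 0, X 1, X 2; Y 0, Y 1, Y 2; Z 0, Z 1, Z 2]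

/-! ### Surfaces in `ℝ³` -/

/-- `φ : U → M` is a smooth local parametrization of `M ⊆ ℝ³`: the set `U ⊆ ℝ²` is open, `φ` is
smooth on `U` with injective differential, and it is a homeomorphism from `U` onto a relatively
open subset of `M`. -/
structure IsLocalParam (M : Set E3) (U : Set (ℝ × ℝ)) (φ : ℝ × ℝ → E3) : Prop where
  isOpen : IsOpen U
  contDiffOn : ContDiffOn ℝ ∞ φ U
  isEmbedding : IsEmbedding (U.domRestrict φ)
  injective_fderiv : ∀ x ∈ U, Function.Injective (fderiv ℝ φ x)
  image_eq : ∃ W : Set E3, IsOpen W ∧ φ '' U = M ∩ W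

/-- `M ⊆ ℝ³` is a smooth embedded surface (without boundary). -/
def IsSurface (M : Set E3) : Prop :=
  ∀ p ∈ M, ∃ U φ, IsLocalParam M U φ ∧ p ∈ φ '' U

/-- The tangent plane `T_p M`, spanned by the velocities at `p` of the curves in `M` through `p`.
(For a surface these velocities already form a plane.) -/
def tangentPlane (M : Set E3) (p : E3) : Submodule ℝ E3 :=
  Submodule.span ℝ {v | ∃ γ : ℝ → E3, γ 0 = p ∧ (∀ t, γ t ∈ M) ∧ HasDerivAt γ v 0}

open Classical in
/-- `det (dn_p)` for a map `n : M → ℝ³` whose differential at `p` is an endomorphism of `T_p M`, as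
is the case when `n` is the Euclidean or the Birkhoff-Gauss map. The restriction of
`fderivWithin ℝ n M p` to `T_p M` is the differential of `n` as a map on the surface `M`; only the
values of `n` on `M` matter. -/
def detDifferential (M : Set E3) (n : E3 → E3) (p : E3) : ℝ :=
  if h : ∀ v ∈ tangentPlane M p,
      (fderivWithin ℝ n M p : E3 →ₗ[ℝ] E3) v ∈ tangentPlane M p then
    LinearMap.det ((fderivWithin ℝ n M p : E3 →ₗ[ℝ] E3).restrict h)
  else 0

/-! ### The ambient norm -/

/-- The unit sphere `∂B` of the norm `N`. -/
def unitSphere (N : Seminorm ℝ E3) : Set E3 := {x | N x = 1}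

/-- The usual (Euclidean) outward Gauss map of the unit sphere `∂B`, `x ↦ ∇N(x) / |∇N(x)|`. -/
def sphereGaussMap (N : Seminorm ℝ E3) (x : E3) : E3 :=
  ‖gradient (fun y => N y) x‖⁻¹ • gradient (fun y => N y) x

/-- The standing assumptions on the Minkowski norm: it is a norm, it is smooth (away from the
origin) and strictly convex, and the usual Gaussian curvature of its unit sphere vanishes
nowhere. -/
structure IsAdmissibleNorm (N : Seminorm ℝ E3) : Prop where
  definite : ∀ x, N x = 0 → x = 0
  smooth : ContDiffOn ℝ ∞ (fun x => N x) {0}ᶜ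
  strictConvex : StrictConvex ℝ {x | N x ≤ 1}
  gaussCurvature_ne_zero :
    ∀ x ∈ unitSphere N, detDifferential (unitSphere N) (sphereGaussMap N) x ≠ 0

/-- The vector `v` is Birkhoff orthogonal to the plane `H`. -/
def BirkhoffOrthogonal (N : Seminorm ℝ E3) (v : E3) (H : Submodule ℝ E3) : Prop :=
  ∀ w ∈ H, ∀ t : ℝ, N v ≤ N (v + t • w)

/-- `η` is a Birkhoff-Gauss map of `M`: a continuous field along `M` of vectors of `∂B` that are
Birkhoff orthogonal to the tangent planes. Such a field is determined up to the sign on each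
component, that is, by an orientation of `M`. -/
structure IsBirkhoffGaussMap (N : Seminorm ℝ E3) (M : Set E3) (η : E3 → E3) : Prop where
  continuousOn : ContinuousOn η M
  mem_unitSphere : ∀ p ∈ M, η p ∈ unitSphere N
  orthogonal : ∀ p ∈ M, BirkhoffOrthogonal N (η p) (tangentPlane M p)

/-- The Minkowski Gaussian curvature `K(p) = det (dη_p)`. -/
def gaussCurvature (M : Set E3) (η : E3 → E3) (p : E3) : ℝ := detDifferential M η p

/-! ### The area element -/

/-- The area element `ω(X, Y) = det (X, Y, η)` at `p`. -/
def areaForm (η : E3 → E3) (p X Y : E3) : ℝ := det3 X Y (η p)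

/-- The area measure of a coordinate patch: the image under `φ : U → M` of the measure
`|ω(φ_u, φ_v)| du dv`. (The absolute value takes care of parametrizations that do not agree with
the orientation for which `ω` is positive.) -/
def patchMeasure (η : E3 → E3) (U : Set (ℝ × ℝ)) (φ : ℝ × ℝ → E3) : Measure E3 :=
  ((volume.restrict U).withDensity fun x =>
    ENNReal.ofReal |areaForm η (φ x) (fderiv ℝ φ x (1, 0)) (fderiv ℝ φ x (0, 1))|).map φ

/-- The measure `λ_M` of integration against `ω` over `M` (oriented so that `ω` is positive).
By the change of variables formula any two patch measures agree on the overlap of the patches; so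
there is exactly one measure that is concentrated on `M` and restricts to the patch measure on each
coordinate patch, and it is the least measure that dominates all the patch measures. -/
def areaMeasure (M : Set E3) (η : E3 → E3) : Measure E3 :=
  sSup {μ | ∃ U φ, IsLocalParam M U φ ∧ μ = patchMeasure η U φ}

/-! ### Tubes -/

/-- The distance `inf {‖z - p‖ : p ∈ M}` from `z` to `M`, in the norm `N`. -/
def normDist (N : Seminorm ℝ E3) (z : E3) (M : Set E3) : ℝ := sInf ((fun p => N (z - p)) '' M)

/-- The `ε`-tube around `M` in the norm `N`. -/
def tube (N : Seminorm ℝ E3) (M : Set E3) (ε : ℝ) : Set E3 := {z | normDist N z M ≤ ε}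

end Minkowski

end

noncomputable section

namespace Minkowski

section Norm

variable {N : Seminorm ℝ E3}

theorem seminorm_continuous (N : Seminorm ℝ E3) : Continuous fun x => N x := by
  have h := N.convexOn.continuousOn_interior
  simpa [continuousOn_univ] using h

theorem IsAdmissibleNorm.contDiffAt (hN : IsAdmissibleNorm N) {x : E3} (hx : x ≠ 0) :
    ContDiffAt ℝ ∞ (fun y => N y) x :=
  hN.smooth.contDiffAt (isOpen_compl_singleton.mem_nhds hx)

theorem IsAdmissibleNorm.differentiableAt (hN : IsAdmissibleNorm N) {x : E3} (hx : x ≠ 0) :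
    DifferentiableAt ℝ (fun y => N y) x :=
  (hN.contDiffAt hx).differentiableAt (by simp)

theorem ne_zero_of_mem_unitSphere {x : E3} (hx : N x = 1) : x ≠ 0 := by
  rintro rfl
  simp at hx

/-- The derivative of the norm along a straight line. -/
theorem IsAdmissibleNorm.hasDerivAt_line (hN : IsAdmissibleNorm N) {x : E3} (hx : x ≠ 0) (w : E3) :
    HasDerivAt (fun t : ℝ => N (x + t • w)) (fderiv ℝ (fun y => N y) x w) 0 := by
  have h1 : HasDerivAt (fun t : ℝ => x + t • w) w 0 := by
    simpa using ((hasDerivAt_id (0 : ℝ)).smul_const w).const_add x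
  have h2 : HasFDerivAt (fun y => N y) (fderiv ℝ (fun y => N y) x) (x + (0 : ℝ) • w) := by
    simpa using (hN.differentiableAt hx).hasFDerivAt
  exact h2.comp_hasDerivAt (0 : ℝ) h1

theorem IsAdmissibleNorm.fderiv_self (hN : IsAdmissibleNorm N) {x : E3} (hx : x ≠ 0) :
    fderiv ℝ (fun y => N y) x x = N x := by
  have h1 := hN.hasDerivAt_line hx x
  have h2 : HasDerivAt (fun t : ℝ => (1 + t) * N x) (N x) 0 := by
    simpa using ((hasDerivAt_id (0 : ℝ)).const_add 1).mul_const (N x)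
  refine h1.unique (h2.congr_of_eventuallyEq ?_)
  filter_upwards [eventually_gt_nhds (show (-1 : ℝ) < 0 by norm_num)] with t ht
  have : x + t • x = (1 + t) • x := by module
  rw [this, map_smul_eq_mul, Real.norm_of_nonneg (by linarith)]

theorem IsAdmissibleNorm.fderiv_le (hN : IsAdmissibleNorm N) {x : E3} (hx : x ≠ 0) (y : E3) :
    fderiv ℝ (fun y => N y) x y ≤ N y := by
  have h1 := (hN.hasDerivAt_line hx y).tendsto_slope_zero_right
  refine le_of_tendsto h1 ?_
  filter_upwards [self_mem_nhdsWithin] with t (ht : 0 < t)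
  simp only [zero_add, zero_smul, add_zero, smul_eq_mul]
  have h2 := map_add_le_add N x (t • y)
  rw [map_smul_eq_mul, Real.norm_of_nonneg ht.le] at h2
  rw [inv_mul_le_iff₀ ht]
  linarith

theorem IsAdmissibleNorm.abs_fderiv_le (hN : IsAdmissibleNorm N) {x : E3} (hx : x ≠ 0) (y : E3) :
    |fderiv ℝ (fun y => N y) x y| ≤ N y := by
  refine abs_le.2 ⟨?_, hN.fderiv_le hx y⟩
  have := hN.fderiv_le hx (-y)
  rw [map_neg, map_neg_eq_map] at this
  linarith

/-- A supporting plane of the unit ball touches it in one point only. -/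
theorem IsAdmissibleNorm.eq_of_fderiv_eq_one (hN : IsAdmissibleNorm N) {a z : E3} (ha : N a = 1)
    (hz : N z = 1) (h : fderiv ℝ (fun y => N y) a z = 1) : z = a := by
  by_contra hne
  have ha0 := ne_zero_of_mem_unitSphere ha
  have hmid := hN.strictConvex (show z ∈ {x | N x ≤ 1} from hz.le)
    (show a ∈ {x | N x ≤ 1} from ha.le) hne (show (0 : ℝ) < 1 / 2 by norm_num)
    (show (0 : ℝ) < 1 / 2 by norm_num) (by norm_num)
  set m := (1 / 2 : ℝ) • z + (1 / 2 : ℝ) • a with hm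
  have hdm : fderiv ℝ (fun y => N y) a m = 1 := by
    rw [hm, map_add, map_smul, map_smul, h, hN.fderiv_self ha0, ha]
    norm_num
  have hcont : Filter.Tendsto (fun t : ℝ => (1 + t) • m) (𝓝[>] 0) (𝓝 m) := by
    have : Continuous fun t : ℝ => (1 + t) • m := by fun_prop
    simpa using (this.tendsto 0).mono_left nhdsWithin_le_nhds
  have hev := hcont.eventually (mem_interior_iff_mem_nhds.1 hmid)
  obtain ⟨t, ht, ht0⟩ := (hev.and self_mem_nhdsWithin).exists
  have h1 := hN.fderiv_le ha0 ((1 + t) • m)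
  rw [map_smul, hdm, smul_eq_mul, mul_one] at h1
  have h2 : N ((1 + t) • m) ≤ 1 := ht
  have h3 : (0 : ℝ) < t := ht0
  linarith

/-- Up to the sign, the direction that is Birkhoff orthogonal to a plane is unique. -/
theorem IsAdmissibleNorm.eq_or_eq_neg (hN : IsAdmissibleNorm N) {a z : E3} (ha : N a = 1)
    (hz : N z = 1)
    (h : ∀ w, fderiv ℝ (fun y => N y) a w = 0 → fderiv ℝ (fun y => N y) z w = 0) :
    z = a ∨ z = -a := by
  have ha0 := ne_zero_of_mem_unitSphere ha
  have hz0 := ne_zero_of_mem_unitSphere hz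
  have hza : |fderiv ℝ (fun y => N y) z a| ≤ 1 := ha ▸ hN.abs_fderiv_le hz0 a
  have haz : |fderiv ℝ (fun y => N y) a z| ≤ 1 := hz ▸ hN.abs_fderiv_le ha0 z
  have hkey := h (z - fderiv ℝ (fun y => N y) a z • a) (by
    rw [map_sub, map_smul, hN.fderiv_self ha0, ha]; simp)
  rw [map_sub, map_smul, hN.fderiv_self hz0, hz, smul_eq_mul, sub_eq_zero] at hkey
  set α := fderiv ℝ (fun y => N y) a z with hα
  have hα1 : 1 ≤ |α| := by
    have : (1 : ℝ) = |α| * |fderiv ℝ (fun y => N y) z a| := by rw [← abs_mul, ← hkey, abs_one]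
    nlinarith [abs_nonneg α]
  rcases eq_or_eq_neg_of_abs_eq (le_antisymm haz hα1) with h1 | h1
  · exact Or.inl (hN.eq_of_fderiv_eq_one ha hz h1)
  · refine Or.inr (neg_eq_iff_eq_neg.1 (hN.eq_of_fderiv_eq_one ha (by rwa [map_neg_eq_map]) ?_))
    rw [map_neg, ← hα, h1, neg_neg]

theorem BirkhoffOrthogonal.fderiv_eq_zero (hN : IsAdmissibleNorm N) {v : E3} (hv : v ≠ 0)
    {H : Submodule ℝ E3} (h : BirkhoffOrthogonal N v H) {w : E3} (hw : w ∈ H) :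
    fderiv ℝ (fun y => N y) v w = 0 := by
  refine IsLocalMin.hasDerivAt_eq_zero (Filter.Eventually.of_forall fun t => ?_)
    (hN.hasDerivAt_line hv w)
  simpa using h w hw t

/-- The second derivative of the norm at a point of the unit sphere is nondegenerate on the
tangent plane, since the Gaussian curvature does not vanish. -/
theorem IsAdmissibleNorm.hessian_nondegenerate (hN : IsAdmissibleNorm N) {x : E3} (hx : N x = 1)
    {w : E3} (hw : fderiv ℝ (fun y => N y) x w = 0)
    (h : ∀ u, fderiv ℝ (fun y => N y) x u = 0 →
      fderiv ℝ (fderiv ℝ (fun y => N y)) x w u = 0) : w = 0 := by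
  have hx0 := ne_zero_of_mem_unitSphere hx
  set g : E3 → E3 := gradient fun y => N y with hg
  have hgE : ∀ y, g y = (InnerProductSpace.toDual ℝ E3).symm (fderiv ℝ (fun y => N y) y) :=
    fun y => rfl
  have hinner : ∀ y u, inner ℝ (g y) u = fderiv ℝ (fun y => N y) y u := fun y u => by
    rw [hgE, InnerProductSpace.toDual_symm_apply]
  have hg0 : g x ≠ 0 := by
    intro h0
    have := hinner x x
    rw [h0, inner_zero_left, hN.fderiv_self hx0, hx] at this
    exact zero_ne_one this
  have hD : DifferentiableAt ℝ (fderiv ℝ (fun y => N y)) x :=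
    ((hN.contDiffAt hx0).fderiv_right (m := 1) (by norm_cast)).differentiableAt (by simp)
  have hline : HasDerivAt (fun t : ℝ => x + t • w) w 0 := by
    simpa using ((hasDerivAt_id (0 : ℝ)).smul_const w).const_add x
  have hN1 := hN.hasDerivAt_line hx0 w
  rw [hw] at hN1
  set γ₀ : ℝ → E3 := fun t => (N (x + t • w))⁻¹ • (x + t • w) with hγ₀
  have hγ₀d : HasDerivAt γ₀ w 0 :=
    ((hN1.fun_inv (by simp [hx])).fun_smul hline).congr_deriv (by simp [hx])
  have hev : ∀ᶠ t in 𝓝 (0 : ℝ), x + t • w ≠ 0 := by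
    have : Filter.Tendsto (fun t : ℝ => x + t • w) (𝓝 0) (𝓝 x) := by
      simpa using hline.continuousAt.tendsto
    exact this.eventually_ne hx0
  set γ : ℝ → E3 := fun t => if x + t • w = 0 then x else γ₀ t with hγ
  have hγe : γ =ᶠ[𝓝 0] γ₀ := by
    filter_upwards [hev] with t ht
    simp [hγ, ht]
  have hγd : HasDerivAt γ w 0 := hγ₀d.congr_of_eventuallyEq hγe
  have hγ0 : γ 0 = x := by simp [hγ, hγ₀, hx]
  have hγM : ∀ t, γ t ∈ unitSphere N := by
    intro t
    by_cases ht : x + t • w = 0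
    · simp [hγ, ht, unitSphere, hx]
    · have hne : N (x + t • w) ≠ 0 := fun h0 => ht (hN.definite _ h0)
      have hn0 : (0 : ℝ) ≤ N (x + t • w) := apply_nonneg N _
      have : γ t = (N (x + t • w))⁻¹ • (x + t • w) := if_neg ht
      rw [unitSphere, mem_ofPred_eq, this, map_smul_eq_mul, Real.norm_of_nonneg (inv_nonneg.2 hn0),
        inv_mul_cancel₀ hne]
  have hwT : w ∈ tangentPlane (unitSphere N) x :=
    Submodule.subset_span ⟨γ, hγ0, hγM, hγd⟩
  let R : (E3 →L[ℝ] ℝ) →L[ℝ] E3 := LinearMap.toContinuousLinearMap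
    { toFun := fun f => (InnerProductSpace.toDual ℝ E3).symm f
      map_add' := fun f f' => map_add _ f f'
      map_smul' := fun a f => by simp }
  have hgd : HasDerivAt (fun t => g (γ t)) ((InnerProductSpace.toDual ℝ E3).symm
      (fderiv ℝ (fderiv ℝ (fun y => N y)) x w)) 0 := by
    have h1 : HasFDerivAt g (R.comp (fderiv ℝ (fderiv ℝ (fun y => N y)) x)) x :=
      R.hasFDerivAt.comp x hD.hasFDerivAt
    rw [← hγ0] at h1
    have := h1.comp_hasDerivAt (0 : ℝ) hγd
    rw [hγ0] at this
    exact this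
  set c : ℝ := fderiv ℝ (fderiv ℝ (fun y => N y)) x w x with hc
  have hgc : (InnerProductSpace.toDual ℝ E3).symm
      (fderiv ℝ (fderiv ℝ (fun y => N y)) x w) = c • g x := by
    refine ext_inner_right ℝ fun u => ?_
    rw [InnerProductSpace.toDual_symm_apply, inner_smul_left, hinner]
    have := h (u - fderiv ℝ (fun y => N y) x u • x) (by
      rw [map_sub, map_smul, hN.fderiv_self hx0, hx]; simp)
    rw [map_sub, map_smul, sub_eq_zero] at this
    rw [this]
    simp [hc, mul_comm]
  rw [hgc] at hgd
  have hgγ0 : g (γ 0) ≠ 0 := by rwa [hγ0]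
  have hnd : DifferentiableAt ℝ (fun t => ‖g (γ t)‖⁻¹) 0 :=
    (hgd.differentiableAt.norm ℝ hgγ0).inv (by simpa using hgγ0)
  obtain ⟨α, hα⟩ : ∃ α : ℝ, HasDerivAt (fun t => sphereGaussMap N (γ t)) (α • g x) 0 := by
    have h1 := hnd.hasDerivAt.smul hgd
    refine ⟨‖g x‖⁻¹ * c + deriv (fun t => ‖g (γ t)‖⁻¹) 0, h1.congr_deriv ?_⟩
    simp only [hγ0]
    module
  have hα0 : α = 0 := by
    have h1 := hα.inner ℝ hα
    have h2 : (fun t => inner ℝ (sphereGaussMap N (γ t)) (sphereGaussMap N (γ t)))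
        =ᶠ[𝓝 (0 : ℝ)] fun _ => (1 : ℝ) := by
      filter_upwards [hgd.continuousAt.eventually_ne hgγ0] with t ht
      rw [real_inner_self_eq_norm_sq, sphereGaussMap, norm_smul, norm_inv, norm_norm,
        inv_mul_cancel₀ (norm_ne_zero_iff.2 ht), one_pow]
    have h3 := h1.unique ((hasDerivAt_const (0 : ℝ) (1 : ℝ)).congr_of_eventuallyEq h2)
    rw [sphereGaussMap, hγ0, ← hg] at h3
    simp only [inner_smul_left, inner_smul_right, real_inner_self_eq_norm_sq] at h3
    have h4 : ‖g x‖ ≠ 0 := norm_ne_zero_iff.2 hg0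
    simp only [conj_trivial] at h3
    field_simp at h3
    nlinarith [mul_eq_zero.1 h3 |>.resolve_right (by norm_num) |> mul_eq_zero.1 |>.resolve_right h4]
  rw [hα0, zero_smul] at hα
  have hGd : DifferentiableAt ℝ (sphereGaussMap N) x := by
    have h1 : DifferentiableAt ℝ g x :=
      R.differentiableAt.comp x hD
    exact ((h1.norm ℝ hg0).inv (by simpa using hg0)).smul h1
  have hGw : fderivWithin ℝ (sphereGaussMap N) (unitSphere N) x w = 0 := by
    have h1 := hGd.differentiableWithinAt (s := unitSphere N) |>.hasFDerivWithinAt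
    rw [← hγ0] at h1
    have h2 := h1.comp_hasDerivAt (0 : ℝ) hγd (Filter.Eventually.of_forall hγM)
    rw [hγ0] at h2
    exact h2.unique hα
  by_contra hw0
  refine hN.gaussCurvature_ne_zero x hx ?_
  rw [detDifferential]
  split_ifs with hT
  · rw [LinearMap.det_eq_zero_iff_ker_ne_bot]
    intro hbot
    have : (⟨w, hwT⟩ : tangentPlane (unitSphere N) x) ∈ LinearMap.ker
        ((fderivWithin ℝ (sphereGaussMap N) (unitSphere N) x : E3 →ₗ[ℝ] E3).restrict hT) := by
      rw [LinearMap.mem_ker]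
      exact Subtype.ext hGw
    rw [hbot, Submodule.mem_bot] at this
    exact hw0 (congrArg Subtype.val this)
  · rfl

end Norm

section Surface

variable {M : Set E3} {U : Set (ℝ × ℝ)} {φ : ℝ × ℝ → E3} {x : ℝ × ℝ}

namespace IsLocalParam

theorem contDiffAt (h : IsLocalParam M U φ) (hx : x ∈ U) : ContDiffAt ℝ ∞ φ x :=
  h.contDiffOn.contDiffAt (h.isOpen.mem_nhds hx)

theorem hasFDerivAt (h : IsLocalParam M U φ) (hx : x ∈ U) : HasFDerivAt φ (fderiv ℝ φ x) x :=
  ((h.contDiffAt hx).differentiableAt (by simp)).hasFDerivAt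

theorem mapsTo (h : IsLocalParam M U φ) : MapsTo φ U M := by
  obtain ⟨W, -, hW⟩ := h.image_eq
  exact fun x hx => (hW ▸ mem_image_of_mem φ hx : φ x ∈ M ∩ W).1

theorem injOn (h : IsLocalParam M U φ) : InjOn φ U :=
  injOn_iff_injective.2 h.isEmbedding.injective

theorem map_nhds (h : IsLocalParam M U φ) (hx : x ∈ U) :
    Filter.map φ (𝓝 x) = 𝓝[M] (φ x) := by
  obtain ⟨W, hWo, hW⟩ := h.image_eq
  have h1 := h.isEmbedding.map_nhds_eq ⟨x, hx⟩
  rw [range_domRestrict, hW, domRestrict_apply,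
    nhdsWithin_inter_of_mem' (nhdsWithin_le_nhds (hWo.mem_nhds
      (hW ▸ mem_image_of_mem φ hx : φ x ∈ M ∩ W).2))] at h1
  rw [← h1, domRestrict_eq, ← Filter.map_map, map_nhds_subtype_coe_eq_nhds hx
    (h.isOpen.mem_nhds hx)]

theorem isInducing_fderiv (h : IsLocalParam M U φ) (hx : x ∈ U) :
    Topology.IsInducing (fderiv ℝ φ x) :=
  ((fderiv ℝ φ x).toLinearMap.isClosedEmbedding_of_injective
    (LinearMap.ker_eq_bot.2 (h.injective_fderiv x hx))).isInducing

/-- A map whose expression in a local parametrization is differentiable is differentiable along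
the surface. -/
theorem exists_hasFDerivWithinAt {n : E3 → E3} {n' : ℝ × ℝ →L[ℝ] E3} (h : IsLocalParam M U φ)
    (hx : x ∈ U) (hn : HasFDerivAt (n ∘ φ) n' x) :
    ∃ L : E3 →L[ℝ] E3, HasFDerivWithinAt n L M (φ x) ∧ (∀ v, L (fderiv ℝ φ x v) = n' v) ∧
      LinearMap.range L.toLinearMap ≤ LinearMap.range n'.toLinearMap := by
  obtain ⟨P, hP⟩ := (fderiv ℝ φ x).toLinearMap.exists_leftInverse_of_injective
    (LinearMap.ker_eq_bot.2 (h.injective_fderiv x hx))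
  have hP' : ∀ v, P (fderiv ℝ φ x v) = v := fun v => LinearMap.congr_fun hP v
  refine ⟨n'.comp (LinearMap.toContinuousLinearMap P), ?_, fun v => ?_, ?_⟩
  · have hφ := h.hasFDerivAt hx
    rw [hasFDerivWithinAt_iff_isLittleO, ← h.map_nhds hx, Asymptotics.isLittleO_map]
    have h1 := hasFDerivAt_iff_isLittleO.1 hφ
    have h2 := hasFDerivAt_iff_isLittleO.1 hn
    have h3 := (n'.comp (LinearMap.toContinuousLinearMap P)).isBigO_comp
      (fun y => φ y - φ x - fderiv ℝ φ x (y - x)) (𝓝 x) |>.trans_isLittleO h1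
    refine ((h2.sub h3).congr_left fun y => ?_).trans_isTheta
      (hφ.isTheta_sub (h.isInducing_fderiv hx)).symm
    simp only [Function.comp_apply, ContinuousLinearMap.comp_apply, map_sub,
      LinearMap.coe_toContinuousLinearMap', hP']
    abel
  · simp [hP']
  · rintro _ ⟨w, rfl⟩
    exact ⟨P w, rfl⟩

theorem differentiableWithinAt {n : E3 → E3} (h : IsLocalParam M U φ) (hx : x ∈ U)
    (hn : DifferentiableAt ℝ (n ∘ φ) x) : DifferentiableWithinAt ℝ n M (φ x) := by
  obtain ⟨L, hL, -⟩ := h.exists_hasFDerivWithinAt hx hn.hasFDerivAt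
  exact hL.differentiableWithinAt

theorem fderivWithin_apply {n : E3 → E3} (h : IsLocalParam M U φ) (hx : x ∈ U)
    (hn : DifferentiableAt ℝ (n ∘ φ) x) (v : ℝ × ℝ) :
    fderivWithin ℝ n M (φ x) (fderiv ℝ φ x v) = fderiv ℝ (n ∘ φ) x v := by
  have h1 := (h.differentiableWithinAt hx hn).hasFDerivWithinAt.comp x
    (h.hasFDerivAt hx).hasFDerivWithinAt h.mapsTo
  have h2 := (h1.hasFDerivAt (h.isOpen.mem_nhds hx)).unique hn.hasFDerivAt
  exact DFunLike.congr_fun h2 v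

theorem tangentPlane_eq (h : IsLocalParam M U φ) (hx : x ∈ U) :
    tangentPlane M (φ x) = LinearMap.range (fderiv ℝ φ x).toLinearMap := by
  classical
  apply le_antisymm
  · refine Submodule.span_le.2 ?_
    rintro v ⟨γ, hγ0, hγM, hγ⟩
    obtain ⟨L, hL, -, hLr⟩ := h.exists_hasFDerivWithinAt (n := id) hx (h.hasFDerivAt hx)
    rw [← hγ0] at hL
    have h1 := hL.comp_hasDerivAt (0 : ℝ) hγ (Filter.Eventually.of_forall hγM)
    have h2 : v = L v := hγ.unique h1
    rw [h2]
    exact hLr ⟨v, rfl⟩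
  · rintro _ ⟨v, rfl⟩
    refine Submodule.subset_span ?_
    have hline : HasDerivAt (fun t : ℝ => x + t • v) v 0 := by
      simpa using ((hasDerivAt_id (0 : ℝ)).smul_const v).const_add x
    have hev : ∀ᶠ t in 𝓝 (0 : ℝ), x + t • v ∈ U := by
      refine hline.continuousAt.eventually_mem (h.isOpen.mem_nhds ?_)
      simpa using hx
    refine ⟨fun t => if x + t • v ∈ U then φ (x + t • v) else φ x, by simp, fun t => ?_, ?_⟩
    · dsimp only
      split_ifs with ht
      exacts [h.mapsTo ht, h.mapsTo hx]
    · have h1 : HasFDerivAt φ (fderiv ℝ φ x) (x + (0 : ℝ) • v) := by simpa using h.hasFDerivAt hx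
      refine (h1.comp_hasDerivAt (0 : ℝ) hline).congr_of_eventuallyEq ?_
      filter_upwards [hev] with t ht
      simp [ht]

end IsLocalParam

theorem finrank_ker_eq_two {f : E3 →L[ℝ] ℝ} (hf : f ≠ 0) :
    Module.finrank ℝ (LinearMap.ker f.toLinearMap) = 2 := by
  have h1 := f.toLinearMap.finrank_range_add_finrank_ker
  have h2 : LinearMap.range f.toLinearMap = ⊤ := LinearMap.range_eq_top.2
    (LinearMap.surjective (fun h => hf (ContinuousLinearMap.coe_injective h)))
  rw [h2, finrank_top] at h1
  simp at h1
  omega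

theorem IsLocalParam.finrank_range (h : IsLocalParam M U φ) (hx : x ∈ U) :
    Module.finrank ℝ (LinearMap.range (fderiv ℝ φ x).toLinearMap) = 2 := by
  rw [LinearMap.finrank_range_of_inj (h.injective_fderiv x hx)]
  simp

variable {N : Seminorm ℝ E3} {η : E3 → E3}

/-- The tangent plane of the surface is the tangent plane of the unit sphere at the
corresponding point. -/
theorem IsBirkhoffGaussMap.range_fderiv_eq_ker (hN : IsAdmissibleNorm N)
    (hη : IsBirkhoffGaussMap N M η) (h : IsLocalParam M U φ) (hx : x ∈ U) :
    LinearMap.range (fderiv ℝ φ x).toLinearMap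
      = LinearMap.ker (fderiv ℝ (fun y => N y) (η (φ x))).toLinearMap := by
  have hp := h.mapsTo hx
  have h1 : N (η (φ x)) = 1 := hη.mem_unitSphere _ hp
  have h0 := ne_zero_of_mem_unitSphere h1
  refine Submodule.eq_of_le_of_finrank_eq ?_ ?_
  · rw [← h.tangentPlane_eq hx]
    exact fun w hw => (hη.orthogonal _ hp).fderiv_eq_zero hN h0 hw
  · rw [h.finrank_range hx, finrank_ker_eq_two]
    intro h2
    have := hN.fderiv_self h0
    rw [h2, h1] at this
    simp at this

theorem IsBirkhoffGaussMap.fderiv_fderiv_apply (hN : IsAdmissibleNorm N)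
    (hη : IsBirkhoffGaussMap N M η) (h : IsLocalParam M U φ) (hx : x ∈ U) (v : ℝ × ℝ) :
    fderiv ℝ (fun y => N y) (η (φ x)) (fderiv ℝ φ x v) = 0 := by
  have : fderiv ℝ φ x v ∈ LinearMap.range (fderiv ℝ φ x).toLinearMap := ⟨v, rfl⟩
  rw [hη.range_fderiv_eq_ker hN h hx] at this
  exact this

theorem IsBirkhoffGaussMap.continuousOn_comp (hη : IsBirkhoffGaussMap N M η)
    (h : IsLocalParam M U φ) : ContinuousOn (η ∘ φ) U :=
  hη.continuousOn.comp h.contDiffOn.continuousOn h.mapsTo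

end Surface

section

variable {M : Set E3} {U : Set (ℝ × ℝ)} {φ : ℝ × ℝ → E3} {x : ℝ × ℝ} {N : Seminorm ℝ E3}
  {η : E3 → E3}

/-- In a local parametrization the Birkhoff-Gauss map is smooth: it solves the equations `N y = 1`,
`dN_y (φ_u) = 0`, `dN_y (φ_v) = 0`. -/
theorem IsBirkhoffGaussMap.contDiffAt_comp (hN : IsAdmissibleNorm N)
    (hη : IsBirkhoffGaussMap N M η) (h : IsLocalParam M U φ) (hx : x ∈ U) :
    ContDiffAt ℝ 1 (η ∘ φ) x := by
  set f : (ℝ × ℝ) × E3 → ℝ × ℝ × ℝ := fun q => (N q.2,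
    fderiv ℝ (fun y => N y) q.2 (fderiv ℝ φ q.1 (1, 0)),
    fderiv ℝ (fun y => N y) q.2 (fderiv ℝ φ q.1 (0, 1))) with hf
  have hN1 : ∀ z ∈ U, N (η (φ z)) = 1 := fun z hz => hη.mem_unitSphere _ (h.mapsTo hz)
  set y := η (φ x) with hy
  have hy0 : y ≠ 0 := ne_zero_of_mem_unitSphere (hN1 x hx)
  have hdN : ContDiffAt ℝ 1 (fderiv ℝ (fun y => N y)) y :=
    (hN.contDiffAt hy0).fderiv_right (by norm_cast)
  have hdφ : ContDiffAt ℝ 1 (fderiv ℝ φ) x := (h.contDiffAt hx).fderiv_right (by norm_cast)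
  have hdN' : ContDiffAt ℝ 1 (fun q : (ℝ × ℝ) × E3 => fderiv ℝ (fun y => N y) q.2) (x, y) :=
    ContDiffAt.comp (x, y) hdN contDiffAt_snd
  have hdφ' : ∀ v, ContDiffAt ℝ 1 (fun q : (ℝ × ℝ) × E3 => fderiv ℝ φ q.1 v) (x, y) := fun v =>
    (ContDiffAt.comp (x, y) hdφ contDiffAt_fst).clm_apply contDiffAt_const
  have hNq : ContDiffAt ℝ 1 (fun q : (ℝ × ℝ) × E3 => N q.2) (x, y) :=
    ContDiffAt.comp (x, y) ((hN.contDiffAt hy0).of_le (by norm_cast)) contDiffAt_snd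
  have cdf : ContDiffAt ℝ 1 f (x, y) :=
    hNq.prodMk ((hdN'.clm_apply (hdφ' _)).prodMk (hdN'.clm_apply (hdφ' _)))
  set A := fderiv ℝ f (x, y) ∘L .inr ℝ (ℝ × ℝ) E3 with hA
  have hAd : HasFDerivAt (fun z => f (x, z)) A y := by
    have h1 : HasFDerivAt f (fderiv ℝ f (x, y)) ((fun z => (x, z)) y) :=
      (cdf.differentiableAt (by simp)).hasFDerivAt
    exact h1.comp y (hasFDerivAt_prodMk_right x y)
  have hA1 : ∀ w, (A w).1 = fderiv ℝ (fun y => N y) y w := fun w =>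
    DFunLike.congr_fun (hAd.fst.unique (hN.differentiableAt hy0).hasFDerivAt) w
  have hdNd := (hdN.differentiableAt (by simp)).hasFDerivAt
  have hA2 : ∀ w, (A w).2.1 = fderiv ℝ (fderiv ℝ (fun y => N y)) y w (fderiv ℝ φ x (1, 0)) :=
    fun w => by
      have := DFunLike.congr_fun (hAd.snd.fst.unique
        (hdNd.clm_apply (hasFDerivAt_const (fderiv ℝ φ x (1, 0)) y))) w
      simpa using this
  have hA3 : ∀ w, (A w).2.2 = fderiv ℝ (fderiv ℝ (fun y => N y)) y w (fderiv ℝ φ x (0, 1)) :=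
    fun w => by
      have := DFunLike.congr_fun (hAd.snd.snd.unique
        (hdNd.clm_apply (hasFDerivAt_const (fderiv ℝ φ x (0, 1)) y))) w
      simpa using this
  have hinj : Function.Injective A.toLinearMap := by
    rw [← LinearMap.ker_eq_bot, LinearMap.ker_eq_bot']
    intro w hw
    have hw' : A w = 0 := hw
    refine hN.hessian_nondegenerate (hN1 x hx) ?_ fun u hu => ?_
    · rw [← hy, ← hA1, hw']; rfl
    · have hu' : u ∈ LinearMap.ker (fderiv ℝ (fun y => N y) (η (φ x))).toLinearMap := hu
      rw [← hη.range_fderiv_eq_ker hN h hx] at hu'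
      obtain ⟨⟨a, b⟩, rfl⟩ := hu'
      have hab : ((a, b) : ℝ × ℝ) = a • (1, 0) + b • (0, 1) := by simp
      have e1 := hA2 w
      have e2 := hA3 w
      rw [hw'] at e1 e2
      rw [← hy, hab, map_add, map_smul, map_smul, map_add, map_smul, map_smul]
      change a • fderiv ℝ (fderiv ℝ (fun y => N y)) y w (fderiv ℝ φ x (1, 0))
        + b • fderiv ℝ (fderiv ℝ (fun y => N y)) y w (fderiv ℝ φ x (0, 1)) = 0
      rw [← e1, ← e2]
      simp
  have hinv : A.IsInvertible :=
    ⟨(LinearEquiv.ofInjectiveOfFinrankEq A.toLinearMap hinj (by simp)).toContinuousLinearEquiv,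
      by ext <;> rfl⟩
  refine (cdf.contDiffAt_implicitFunction (by simp) hinv).congr_of_eventuallyEq ?_
  have hcont : Filter.Tendsto (fun z => (z, η (φ z))) (𝓝 x) (𝓝 (x, y)) :=
    Filter.tendsto_id.prodMk_nhds
      ((hη.continuousOn_comp h).continuousAt (h.isOpen.mem_nhds hx)).tendsto
  have hfU : ∀ z ∈ U, f (z, η (φ z)) = (1, 0, 0) := fun z hz => by
    simp only [hf, hN1 z hz, hη.fderiv_fderiv_apply hN h hz]
  filter_upwards [hcont.eventually (cdf.eventually_apply_eq_iff_implicitFunction (by simp) hinv),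
    h.isOpen.mem_nhds hx] with z hz hzU
  exact (hz.1 ((hfU z hzU).trans (hfU x hx).symm)).symm

theorem IsBirkhoffGaussMap.contDiffOn_comp (hN : IsAdmissibleNorm N)
    (hη : IsBirkhoffGaussMap N M η) (h : IsLocalParam M U φ) : ContDiffOn ℝ 1 (η ∘ φ) U :=
  fun _ hz => (hη.contDiffAt_comp hN h hz).contDiffWithinAt

end

section

variable {M : Set E3} {U : Set (ℝ × ℝ)} {φ : ℝ × ℝ → E3} {x : ℝ × ℝ} {N : Seminorm ℝ E3}
  {η : E3 → E3}

open Classical in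
/-- The trace of the differential of `η`, as an endomorphism of the tangent plane: twice the
Minkowski mean curvature. -/
def traceDifferential (M : Set E3) (n : E3 → E3) (p : E3) : ℝ :=
  if h : ∀ v ∈ tangentPlane M p,
      (fderivWithin ℝ n M p : E3 →ₗ[ℝ] E3) v ∈ tangentPlane M p then
    LinearMap.trace ℝ _ ((fderivWithin ℝ n M p : E3 →ₗ[ℝ] E3).restrict h)
  else 0

theorem IsBirkhoffGaussMap.fderiv_comp_mem (hN : IsAdmissibleNorm N)
    (hη : IsBirkhoffGaussMap N M η) (h : IsLocalParam M U φ) (hx : x ∈ U) (v : ℝ × ℝ) :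
    fderiv ℝ (η ∘ φ) x v ∈ LinearMap.range (fderiv ℝ φ x).toLinearMap := by
  have h1 : N (η (φ x)) = 1 := hη.mem_unitSphere _ (h.mapsTo hx)
  have hd := (hη.contDiffAt_comp hN h hx).differentiableAt (by simp) |>.hasFDerivAt
  have hNd := (hN.differentiableAt (ne_zero_of_mem_unitSphere h1)).hasFDerivAt
  have h2 : HasFDerivAt ((fun y => N y) ∘ (η ∘ φ)) _ x := HasFDerivAt.comp x hNd hd
  have h3 : (fun y => N y) ∘ (η ∘ φ) =ᶠ[𝓝 x] fun _ => (1 : ℝ) := by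
    filter_upwards [h.isOpen.mem_nhds hx] with z hz
    exact hη.mem_unitSphere _ (h.mapsTo hz)
  have h4 := h2.unique ((hasFDerivAt_const (1 : ℝ) x).congr_of_eventuallyEq h3)
  rw [hη.range_fderiv_eq_ker hN h hx]
  exact DFunLike.congr_fun h4 v

/-- The Weingarten equations. -/
theorem IsBirkhoffGaussMap.weingarten (hN : IsAdmissibleNorm N)
    (hη : IsBirkhoffGaussMap N M η) (h : IsLocalParam M U φ) (hx : x ∈ U) :
    ∃ a b c d : ℝ,
      fderiv ℝ (η ∘ φ) x (1, 0) = a • fderiv ℝ φ x (1, 0) + b • fderiv ℝ φ x (0, 1) ∧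
      fderiv ℝ (η ∘ φ) x (0, 1) = c • fderiv ℝ φ x (1, 0) + d • fderiv ℝ φ x (0, 1) ∧
      gaussCurvature M η (φ x) = a * d - b * c ∧ traceDifferential M η (φ x) = a + d := by
  have hd := (hη.contDiffAt_comp hN h hx).differentiableAt (by simp)
  have hT := h.tangentPlane_eq hx
  have hmem := hη.fderiv_comp_mem hN h hx
  obtain ⟨⟨a, b⟩, hab⟩ := hmem (1, 0)
  obtain ⟨⟨c, d⟩, hcd⟩ := hmem (0, 1)
  have hsplit : ∀ s t : ℝ, (fderiv ℝ φ x).toLinearMap (s, t)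
      = s • fderiv ℝ φ x (1, 0) + t • fderiv ℝ φ x (0, 1) := fun s t => by
    have : ((s, t) : ℝ × ℝ) = s • (1, 0) + t • (0, 1) := by simp
    rw [this, map_add, map_smul, map_smul]
    rfl
  rw [hsplit] at hab hcd
  have hmaps : ∀ v ∈ tangentPlane M (φ x),
      (fderivWithin ℝ η M (φ x) : E3 →ₗ[ℝ] E3) v ∈ tangentPlane M (φ x) := by
    intro v hv
    rw [hT] at hv ⊢
    obtain ⟨u, rfl⟩ := hv
    have := h.fderivWithin_apply hx hd u
    exact (congrArg (· ∈ LinearMap.range (fderiv ℝ φ x).toLinearMap) this).mpr (hmem u)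
  let e : (ℝ × ℝ) ≃ₗ[ℝ] tangentPlane M (φ x) :=
    (LinearEquiv.ofInjective (fderiv ℝ φ x).toLinearMap (h.injective_fderiv x hx)).trans
      (LinearEquiv.ofEq _ _ hT.symm)
  have he : ∀ v, (e v : E3) = fderiv ℝ φ x v := fun v => rfl
  let B := (Module.Basis.finTwoProd ℝ).map e
  have hB0 : B 0 = e (1, 0) := by simp [B]
  have hB1 : B 1 = e (0, 1) := by simp [B]
  set S := (fderivWithin ℝ η M (φ x) : E3 →ₗ[ℝ] E3).restrict hmaps with hS
  have hSe : ∀ v, (S (e v) : E3) = fderiv ℝ (η ∘ φ) x v := fun v => h.fderivWithin_apply hx hd v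
  have hS0 : S (B 0) = a • B 0 + b • B 1 := by
    refine Subtype.ext ?_
    rw [hB0, hB1, hSe, ← hab]
    rfl
  have hS1 : S (B 1) = c • B 0 + d • B 1 := by
    refine Subtype.ext ?_
    rw [hB0, hB1, hSe, ← hcd]
    rfl
  refine ⟨a, b, c, d, hab.symm, hcd.symm, ?_, ?_⟩
  · rw [gaussCurvature, detDifferential, dif_pos hmaps, ← hS, ← LinearMap.det_toMatrix B,
      Matrix.det_fin_two]
    simp only [LinearMap.toMatrix_apply, hS0, hS1, map_add, map_smul, Module.Basis.repr_self]
    simp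
    ring
  · rw [traceDifferential, dif_pos hmaps, ← hS, LinearMap.trace_eq_matrix_trace ℝ B,
      Matrix.trace_fin_two]
    simp only [LinearMap.toMatrix_apply, hS0, hS1, map_add, map_smul, Module.Basis.repr_self]
    simp

theorem det3_eq (X Y Z : E3) : det3 X Y Z = X 0 * Y 1 * Z 2 - X 0 * Y 2 * Z 1 - X 1 * Y 0 * Z 2
    + X 1 * Y 2 * Z 0 + X 2 * Y 0 * Z 1 - X 2 * Y 1 * Z 0 := by
  simp [det3, Matrix.det_fin_three]

theorem det3_ne_zero {X Y Z : E3} (h : ∀ a b c : ℝ, a • X + b • Y + c • Z = 0 →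
    a = 0 ∧ b = 0 ∧ c = 0) : det3 X Y Z ≠ 0 := by
  intro h0
  obtain ⟨v, hv, hv0⟩ := Matrix.exists_vecMul_eq_zero_iff.2 h0
  refine hv ?_
  obtain ⟨h1, h2, h3⟩ := h (v 0) (v 1) (v 2) (by
    ext i
    have := congrFun hv0 i
    fin_cases i <;> simpa [Matrix.vecMul, dotProduct, Fin.sum_univ_three] using this)
  ext i
  fin_cases i
  exacts [h1, h2, h3]

/-- The area element does not vanish. -/
theorem IsBirkhoffGaussMap.det3_ne_zero (hN : IsAdmissibleNorm N)
    (hη : IsBirkhoffGaussMap N M η) (h : IsLocalParam M U φ) (hx : x ∈ U) :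
    det3 (fderiv ℝ φ x (1, 0)) (fderiv ℝ φ x (0, 1)) (η (φ x)) ≠ 0 := by
  have h1 : N (η (φ x)) = 1 := hη.mem_unitSphere _ (h.mapsTo hx)
  refine Minkowski.det3_ne_zero fun a b c habc => ?_
  have h2 := congrArg (fderiv ℝ (fun y => N y) (η (φ x))) habc
  rw [map_add, map_add, map_smul, map_smul, map_smul, hη.fderiv_fderiv_apply hN h hx,
    hη.fderiv_fderiv_apply hN h hx, hN.fderiv_self (ne_zero_of_mem_unitSphere h1), h1] at h2
  have hc : c = 0 := by simpa using h2
  have h3 : fderiv ℝ φ x (a, b) = fderiv ℝ φ x 0 := by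
    have : ((a, b) : ℝ × ℝ) = a • (1, 0) + b • (0, 1) := by simp
    rw [this, map_add, map_smul, map_smul, map_zero, ← habc, hc, zero_smul, add_zero]
  have h4 := h.injective_fderiv x hx h3
  exact ⟨congrArg Prod.fst h4, congrArg Prod.snd h4, hc⟩

/-- Steiner's formula for the area element of the parallel surfaces. -/
theorem IsBirkhoffGaussMap.det3_parallel (hN : IsAdmissibleNorm N)
    (hη : IsBirkhoffGaussMap N M η) (h : IsLocalParam M U φ) (hx : x ∈ U) (t : ℝ) :
    det3 (fderiv ℝ φ x (1, 0) + t • fderiv ℝ (η ∘ φ) x (1, 0))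
        (fderiv ℝ φ x (0, 1) + t • fderiv ℝ (η ∘ φ) x (0, 1)) (η (φ x))
      = (1 + t * traceDifferential M η (φ x) + t ^ 2 * gaussCurvature M η (φ x))
        * det3 (fderiv ℝ φ x (1, 0)) (fderiv ℝ φ x (0, 1)) (η (φ x)) := by
  obtain ⟨a, b, c, d, h1, h2, h3, h4⟩ := hη.weingarten hN h hx
  rw [h1, h2, h3, h4]
  simp only [det3_eq, PiLp.add_apply, PiLp.smul_apply, smul_eq_mul]
  ring

theorem IsBirkhoffGaussMap.det3_fderiv_comp (hN : IsAdmissibleNorm N)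
    (hη : IsBirkhoffGaussMap N M η) (h : IsLocalParam M U φ) (hx : x ∈ U) :
    det3 (fderiv ℝ (η ∘ φ) x (1, 0)) (fderiv ℝ (η ∘ φ) x (0, 1)) (η (φ x))
      = gaussCurvature M η (φ x)
        * det3 (fderiv ℝ φ x (1, 0)) (fderiv ℝ φ x (0, 1)) (η (φ x)) := by
  obtain ⟨a, b, c, d, h1, h2, h3, h4⟩ := hη.weingarten hN h hx
  rw [h1, h2, h3]
  simp only [det3_eq, PiLp.add_apply, PiLp.smul_apply, smul_eq_mul]
  ring

theorem _root_.ContinuousOn.det3 {α : Type*} [TopologicalSpace α] {s : Set α} {X Y Z : α → E3}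
    (hX : ContinuousOn X s) (hY : ContinuousOn Y s) (hZ : ContinuousOn Z s) :
    ContinuousOn (fun a => Minkowski.det3 (X a) (Y a) (Z a)) s := by
  simp only [det3_eq]
  fun_prop

theorem IsLocalParam.continuousOn_fderiv (h : IsLocalParam M U φ) (v : ℝ × ℝ) :
    ContinuousOn (fun x => fderiv ℝ φ x v) U :=
  (h.contDiffOn.continuousOn_fderiv_of_isOpen h.isOpen (by simp)).clm_apply continuousOn_const

theorem IsBirkhoffGaussMap.continuousOn_fderiv_comp (hN : IsAdmissibleNorm N)
    (hη : IsBirkhoffGaussMap N M η) (h : IsLocalParam M U φ) (v : ℝ × ℝ) :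
    ContinuousOn (fun x => fderiv ℝ (η ∘ φ) x v) U :=
  ((hη.contDiffOn_comp hN h).continuousOn_fderiv_of_isOpen h.isOpen (by simp)).clm_apply
    continuousOn_const

theorem IsSurface.continuousOn {f : E3 → ℝ} (hM : IsSurface M)
    (hf : ∀ U φ, IsLocalParam M U φ → ContinuousOn (f ∘ φ) U) : ContinuousOn f M := by
  intro p hp
  obtain ⟨U, φ, h, x, hx, rfl⟩ := hM p hp
  rw [ContinuousWithinAt, ← h.map_nhds hx, Filter.tendsto_map'_iff]
  exact (hf U φ h).continuousAt (h.isOpen.mem_nhds hx)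

theorem IsBirkhoffGaussMap.continuousOn_gaussCurvature_comp (hN : IsAdmissibleNorm N)
    (hη : IsBirkhoffGaussMap N M η) (h : IsLocalParam M U φ) :
    ContinuousOn (gaussCurvature M η ∘ φ) U := by
  have h1 := ((hη.continuousOn_fderiv_comp hN h (1, 0)).det3
    (hη.continuousOn_fderiv_comp hN h (0, 1)) (hη.continuousOn_comp h)).div
    ((h.continuousOn_fderiv (1, 0)).det3 (h.continuousOn_fderiv (0, 1)) (hη.continuousOn_comp h))
    fun x hx => hη.det3_ne_zero hN h hx
  refine h1.congr fun x hx => ?_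
  rw [Function.comp_apply, Pi.div_apply, Function.comp_apply, eq_div_iff (hη.det3_ne_zero hN h hx),
    hη.det3_fderiv_comp hN h hx]

theorem IsBirkhoffGaussMap.continuousOn_gaussCurvature (hN : IsAdmissibleNorm N)
    (hη : IsBirkhoffGaussMap N M η) (hM : IsSurface M) : ContinuousOn (gaussCurvature M η) M :=
  hM.continuousOn fun _ _ h => hη.continuousOn_gaussCurvature_comp hN h

theorem IsBirkhoffGaussMap.continuousOn_traceDifferential (hN : IsAdmissibleNorm N)
    (hη : IsBirkhoffGaussMap N M η) (hM : IsSurface M) :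
    ContinuousOn (traceDifferential M η) M := by
  refine hM.continuousOn fun U φ h => ?_
  have h1 := (((h.continuousOn_fderiv (1, 0)).add (hη.continuousOn_fderiv_comp hN h (1, 0))).det3
    ((h.continuousOn_fderiv (0, 1)).add (hη.continuousOn_fderiv_comp hN h (0, 1)))
    (hη.continuousOn_comp h)).div
    ((h.continuousOn_fderiv (1, 0)).det3 (h.continuousOn_fderiv (0, 1)) (hη.continuousOn_comp h))
    fun x hx => hη.det3_ne_zero hN h hx
  refine ((h1.sub (hη.continuousOn_gaussCurvature_comp hN h)).sub
    (continuousOn_const (c := (1 : ℝ)))).congr fun x hx => ?_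
  have h2 := hη.det3_parallel hN h hx 1
  rw [one_smul, one_smul] at h2
  simp only [Pi.sub_apply, Pi.div_apply, Function.comp_apply, Pi.add_apply, h2,
    mul_div_cancel_right₀ _ (hη.det3_ne_zero hN h hx)]
  ring

/-- For a compact surface the area element of the parallel surfaces is positive for small
distances. -/
theorem IsBirkhoffGaussMap.exists_steiner_pos (hN : IsAdmissibleNorm N)
    (hη : IsBirkhoffGaussMap N M η) (hM : IsSurface M) (hMc : IsCompact M) :
    ∃ δ : ℝ, 0 < δ ∧ ∀ p ∈ M, ∀ t, |t| < δ →
      0 < 1 + t * traceDifferential M η p + t ^ 2 * gaussCurvature M η p := by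
  obtain ⟨A, hA⟩ := hMc.exists_bound_of_continuousOn (hη.continuousOn_traceDifferential hN hM)
  obtain ⟨B, hB⟩ := hMc.exists_bound_of_continuousOn (hη.continuousOn_gaussCurvature hN hM)
  refine ⟨(1 + |A| + |B|)⁻¹, by positivity, fun p hp t ht => ?_⟩
  have hC : 0 < 1 + |A| + |B| := by positivity
  have h1 : |t| * (1 + |A| + |B|) < 1 := by
    rwa [← lt_div_iff₀ hC, one_div]
  have h2 : |t| ≤ 1 := by nlinarith [abs_nonneg t, abs_nonneg A, abs_nonneg B]
  have hA' : |traceDifferential M η p| ≤ |A| := (hA p hp).trans (le_abs_self A)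
  have hB' : |gaussCurvature M η p| ≤ |B| := (hB p hp).trans (le_abs_self B)
  have h3 : |t * traceDifferential M η p| ≤ |t| * |A| := by
    rw [abs_mul]; gcongr
  have h4 : |t ^ 2 * gaussCurvature M η p| ≤ |t| * |B| := by
    rw [abs_mul, abs_pow, sq]
    have : |t| * |t| ≤ |t| := by nlinarith [abs_nonneg t]
    gcongr
  nlinarith [neg_abs_le (t * traceDifferential M η p), neg_abs_le (t ^ 2 * gaussCurvature M η p),
    abs_nonneg t]

end

section

variable {M : Set E3} {U : Set (ℝ × ℝ)} {φ : ℝ × ℝ → E3} {x : ℝ × ℝ} {N : Seminorm ℝ E3}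
  {η : E3 → E3}

/-- The map `(p, t) ↦ p + t η(p)` that sweeps out the tubes. -/
def normalMap (η : E3 → E3) (q : E3 × ℝ) : E3 := q.1 + q.2 • η q.1

theorem IsBirkhoffGaussMap.continuousOn_normalMap (hη : IsBirkhoffGaussMap N M η) :
    ContinuousOn (normalMap η) (M ×ˢ univ) :=
  continuousOn_fst.add (continuousOn_snd.smul
    (hη.continuousOn.comp continuousOn_fst fun _ hq => hq.1))

/-- A vector of norm one that is normal to the surface is `± η`. -/
theorem IsBirkhoffGaussMap.eq_or_eq_neg (hN : IsAdmissibleNorm N) (hM : IsSurface M)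
    (hη : IsBirkhoffGaussMap N M η) {p u : E3} (hp : p ∈ M) (hu : N u = 1)
    (h : ∀ w ∈ tangentPlane M p, fderiv ℝ (fun y => N y) u w = 0) : u = η p ∨ u = -η p := by
  obtain ⟨U, φ, hφ, x, hx, rfl⟩ := hM p hp
  refine hN.eq_or_eq_neg (hη.mem_unitSphere _ hp) hu fun w hw => h w ?_
  rw [hφ.tangentPlane_eq hx, hη.range_fderiv_eq_ker hN hφ hx]
  exact hw

/-- The segment from a point to a nearest point of the surface is normal to the surface. -/
theorem fderiv_eq_zero_of_isMinOn (hN : IsAdmissibleNorm N) {z p : E3} (hzp : 0 < N (z - p))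
    (hmin : IsMinOn (fun p => N (z - p)) M p) {w : E3} (hw : w ∈ tangentPlane M p) :
    fderiv ℝ (fun y => N y) ((N (z - p))⁻¹ • (z - p)) w = 0 := by
  set s := N (z - p) with hs
  set u := s⁻¹ • (z - p) with hu
  have hu1 : N u = 1 := by
    rw [hu, map_smul_eq_mul, Real.norm_of_nonneg (by positivity), ← hs, inv_mul_cancel₀ hzp.ne']
  have hu0 := ne_zero_of_mem_unitSphere hu1
  have hle : tangentPlane M p ≤ LinearMap.ker (fderiv ℝ (fun y => N y) u).toLinearMap := by
    refine Submodule.span_le.2 ?_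
    rintro v ⟨γ, hγ0, hγM, hγ⟩
    have h1 : HasDerivAt (fun t => s⁻¹ • (z - γ t)) (s⁻¹ • -v) 0 :=
      (hγ.const_sub z).fun_const_smul s⁻¹
    have h2 : HasFDerivAt (fun y => N y) (fderiv ℝ (fun y => N y) u) (s⁻¹ • (z - γ 0)) := by
      rw [hγ0]
      exact (hN.differentiableAt hu0).hasFDerivAt
    have h3 := IsLocalMin.hasDerivAt_eq_zero (Filter.Eventually.of_forall fun t => ?_)
      (h2.comp_hasDerivAt (0 : ℝ) h1)
    · rw [map_smul, map_neg, smul_eq_mul, mul_neg, neg_eq_zero] at h3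
      exact (mul_eq_zero.1 h3).resolve_left (inv_ne_zero hzp.ne')
    · simp only [Function.comp_apply, map_smul_eq_mul, hγ0]
      exact mul_le_mul_of_nonneg_left (hmin (hγM t)) (norm_nonneg _)
  exact hle hw

theorem tube_eq_image (hN : IsAdmissibleNorm N) (hM : IsSurface M) (hMc : IsCompact M)
    (hMne : M.Nonempty) (hη : IsBirkhoffGaussMap N M η) {ε : ℝ} (hε : 0 ≤ ε) :
    tube N M ε = normalMap η '' (M ×ˢ Icc (-ε) ε) := by
  ext z
  constructor
  · intro hz
    have hcont : ContinuousOn (fun p => N (z - p)) M :=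
      ((seminorm_continuous N).comp (continuous_const.sub continuous_id)).continuousOn
    obtain ⟨p, hp, hmin⟩ := hMc.exists_isMinOn hMne hcont
    have hs : N (z - p) ≤ ε :=
      (le_csInf (hMne.image _) (by rintro _ ⟨q, hq, rfl⟩; exact hmin hq)).trans hz
    rcases (apply_nonneg N (z - p)).eq_or_lt with h0 | h0
    · have : z - p = 0 := hN.definite _ h0.symm
      exact ⟨(p, 0), ⟨hp, by simpa using hε⟩, by simp [normalMap, sub_eq_zero.1 this]⟩
    · have hu1 : N ((N (z - p))⁻¹ • (z - p)) = 1 := by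
        rw [map_smul_eq_mul, Real.norm_of_nonneg (by positivity), inv_mul_cancel₀ h0.ne']
      have hz' : z - p = N (z - p) • ((N (z - p))⁻¹ • (z - p)) := by
        rw [smul_smul, mul_inv_cancel₀ h0.ne', one_smul]
      rcases hη.eq_or_eq_neg hN hM hp hu1 (fun w hw => fderiv_eq_zero_of_isMinOn hN h0 hmin hw)
        with h1 | h1
      · refine ⟨(p, N (z - p)), ⟨hp, by simpa using by linarith, hs⟩, ?_⟩
        rw [h1] at hz'
        simp only [normalMap]
        rw [← hz']
        abel
      · refine ⟨(p, -N (z - p)), ⟨hp, by simpa using hs, by simpa using by linarith⟩, ?_⟩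
        rw [h1, smul_neg, ← neg_smul] at hz'
        simp only [normalMap]
        rw [← hz']
        abel
  · rintro ⟨⟨p, t⟩, ⟨hp, ht⟩, rfl⟩
    have h1 : N (η p) = 1 := hη.mem_unitSphere p hp
    have hb : BddBelow ((fun q => N (normalMap η (p, t) - q)) '' M) :=
      ⟨0, by rintro _ ⟨q, -, rfl⟩; exact apply_nonneg N _⟩
    refine (csInf_le hb ⟨p, hp, rfl⟩).trans ?_
    simp only [normalMap, add_sub_cancel_left, map_smul_eq_mul, h1, mul_one]
    exact abs_le.2 ht

/-- The map `(x, t) ↦ φ(x) + t η(φ(x))` has the expected derivative. -/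
theorem IsBirkhoffGaussMap.hasStrictFDerivAt_normalMap (hN : IsAdmissibleNorm N)
    (hη : IsBirkhoffGaussMap N M η) (h : IsLocalParam M U φ) (hx : x ∈ U) (t : ℝ) :
    HasStrictFDerivAt (fun q : (ℝ × ℝ) × ℝ => normalMap η (φ q.1, q.2))
      ((fderiv ℝ φ x + t • fderiv ℝ (η ∘ φ) x) ∘L ContinuousLinearMap.fst ℝ (ℝ × ℝ) ℝ +
        (ContinuousLinearMap.snd ℝ (ℝ × ℝ) ℝ).smulRight (η (φ x))) (x, t) := by
  have h1 : HasStrictFDerivAt φ (fderiv ℝ φ x) ((x, t) : (ℝ × ℝ) × ℝ).1 :=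
    (h.contDiffAt hx).hasStrictFDerivAt (by simp)
  have h2 : HasStrictFDerivAt (η ∘ φ) (fderiv ℝ (η ∘ φ) x) ((x, t) : (ℝ × ℝ) × ℝ).1 :=
    (hη.contDiffAt_comp hN h hx).hasStrictFDerivAt (by simp)
  have h3 := (h1.comp (x, t) hasStrictFDerivAt_fst).add
    ((hasStrictFDerivAt_snd (𝕜 := ℝ) (p := ((x, t) : (ℝ × ℝ) × ℝ))).smul
      (h2.comp (x, t) hasStrictFDerivAt_fst))
  refine h3.congr_fderiv ?_
  ext <;> simp

theorem IsBirkhoffGaussMap.exists_injOn_nhds (hN : IsAdmissibleNorm N)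
    (hη : IsBirkhoffGaussMap N M η) (h : IsLocalParam M U φ) (hx : x ∈ U) :
    ∃ V ∈ 𝓝 ((x, 0) : (ℝ × ℝ) × ℝ),
      InjOn (fun q : (ℝ × ℝ) × ℝ => normalMap η (φ q.1, q.2)) V := by
  have hd := hη.hasStrictFDerivAt_normalMap hN h hx 0
  set A := (fderiv ℝ φ x + (0 : ℝ) • fderiv ℝ (η ∘ φ) x) ∘L ContinuousLinearMap.fst ℝ (ℝ × ℝ) ℝ +
        (ContinuousLinearMap.snd ℝ (ℝ × ℝ) ℝ).smulRight (η (φ x)) with hA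
  have hAq : ∀ q : (ℝ × ℝ) × ℝ, A q = fderiv ℝ φ x q.1 + q.2 • η (φ x) := by
    intro q
    simp [hA]
  have h1 : N (η (φ x)) = 1 := hη.mem_unitSphere _ (h.mapsTo hx)
  have hinj : Function.Injective A.toLinearMap := by
    rw [← LinearMap.ker_eq_bot, LinearMap.ker_eq_bot']
    intro q hq
    have hq' : fderiv ℝ φ x q.1 + q.2 • η (φ x) = 0 := by rw [← hAq]; exact hq
    have h2 := congrArg (fderiv ℝ (fun y => N y) (η (φ x))) hq'
    rw [map_add, map_smul, hη.fderiv_fderiv_apply hN h hx,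
      hN.fderiv_self (ne_zero_of_mem_unitSphere h1), h1] at h2
    have h3 : q.2 = 0 := by simpa using h2
    rw [h3, zero_smul, add_zero] at hq'
    exact Prod.ext (h.injective_fderiv x hx (hq'.trans (map_zero _).symm)) h3
  let e := (LinearEquiv.ofInjectiveOfFinrankEq A.toLinearMap hinj
    (by simp)).toContinuousLinearEquiv
  have hd' : HasStrictFDerivAt (fun q : (ℝ × ℝ) × ℝ => normalMap η (φ q.1, q.2))
      (e : (ℝ × ℝ) × ℝ →L[ℝ] E3) (x, 0) := hd.congr_fderiv (by ext <;> rfl)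
  exact ⟨_, (hd'.toOpenPartialHomeomorph _).open_source.mem_nhds
    hd'.mem_toOpenPartialHomeomorph_source, (hd'.toOpenPartialHomeomorph _).injOn⟩

/-- A compact surface has a tubular neighbourhood. -/
theorem IsBirkhoffGaussMap.exists_injOn_normalMap (hN : IsAdmissibleNorm N)
    (hη : IsBirkhoffGaussMap N M η) (hM : IsSurface M) (hMc : IsCompact M) :
    ∃ δ : ℝ, 0 < δ ∧ InjOn (normalMap η) (M ×ˢ Ioo (-δ) δ) := by
  have : CompactSpace M := isCompact_iff_compactSpace.1 hMc
  set f : M × ℝ → E3 := fun q => normalMap η (q.1, q.2) with hf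
  have hfc : Continuous f := by
    have h1 : Continuous fun q : M × ℝ => (((q.1 : E3), q.2) : E3 × ℝ) := by fun_prop
    exact hη.continuousOn_normalMap.comp_continuous h1 fun q => ⟨q.1.2, mem_univ _⟩
  have hinj : InjOn f (univ ×ˢ {0}) := by
    rintro ⟨p, s⟩ ⟨-, hs⟩ ⟨q, t⟩ ⟨-, ht⟩ hpq
    obtain rfl : s = 0 := hs
    obtain rfl : t = 0 := ht
    simp only [hf, normalMap, zero_smul, add_zero] at hpq
    rw [Subtype.ext hpq]
  have hloc : ∀ q ∈ (univ ×ˢ {0} : Set (M × ℝ)), ∃ u ∈ 𝓝 q, InjOn f u := by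
    rintro ⟨⟨p, hp⟩, s⟩ ⟨-, hs⟩
    obtain rfl : s = 0 := hs
    obtain ⟨U, φ, h, x, hx, rfl⟩ := hM p hp
    obtain ⟨V, hV, hVinj⟩ := hη.exists_injOn_nhds hN h hx
    obtain ⟨V₁, hV₁, V₂, hV₂, hVV⟩ := mem_nhds_prod_iff.1 hV
    have h1 : φ '' V₁ ∈ 𝓝[M] (φ x) := by
      rw [← h.map_nhds hx]
      exact Filter.image_mem_map hV₁
    refine ⟨((↑) ⁻¹' (φ '' V₁)) ×ˢ V₂, prod_mem_nhds
      (preimage_coe_mem_nhds_subtype.2 h1) hV₂, ?_⟩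
    rintro ⟨⟨p, hp⟩, s⟩ ⟨hp', hs⟩ ⟨⟨q, hq⟩, t⟩ ⟨hq', ht⟩ hpq
    obtain ⟨y, hy, hyp⟩ := hp'
    obtain ⟨z, hz, hzq⟩ := hq'
    dsimp only at hyp hzq
    subst hyp hzq
    have h2 := @hVinj (y, s) (hVV ⟨hy, hs⟩) (z, t) (hVV ⟨hz, ht⟩) hpq
    rw [Prod.mk.injEq] at h2
    obtain ⟨rfl, rfl⟩ := h2
    rfl
  obtain ⟨u, hu, hui⟩ := hinj.exists_mem_nhdsSet (isCompact_univ.prod isCompact_singleton)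
    (fun q _ => hfc.continuousAt) hloc
  obtain ⟨u', hu'o, hKu', hu'u⟩ := mem_nhdsSet_iff_exists.1 hu
  obtain ⟨v, w, -, hwo, hv, hw, hvw⟩ := generalized_tube_lemma isCompact_univ isCompact_singleton
    hu'o hKu'
  obtain ⟨δ, hδ, hδw⟩ := Metric.isOpen_iff.1 hwo 0 (hw rfl)
  refine ⟨δ, hδ, ?_⟩
  rintro ⟨p, s⟩ ⟨hp, hs⟩ ⟨q, t⟩ ⟨hq, ht⟩ hpq
  have hmem : ∀ (p : M) (s : ℝ), s ∈ Ioo (-δ) δ → (p, s) ∈ u := fun p s hs =>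
    hu'u (hvw ⟨hv (mem_univ p), hδw (by rwa [Real.ball_eq_Ioo, zero_sub, zero_add])⟩)
  have h1 := hui (hmem ⟨p, hp⟩ s hs) (hmem ⟨q, hq⟩ t ht) hpq
  simpa using h1

end

section

variable {M : Set E3} {U : Set (ℝ × ℝ)} {φ : ℝ × ℝ → E3} {x : ℝ × ℝ} {N : Seminorm ℝ E3}
  {η : E3 → E3}

/-- The identification of `ℝ³` with `ℝ² × ℝ`. -/
def splitLast : E3 ≃L[ℝ] (ℝ × ℝ) × ℝ :=
  LinearEquiv.toContinuousLinearEquiv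
    { toFun := fun y => ((y 0, y 1), y 2)
      invFun := fun q => !₂[q.1.1, q.1.2, q.2]
      map_add' := fun _ _ => rfl
      map_smul' := fun _ _ => rfl
      left_inv := fun y => by ext i; fin_cases i <;> rfl
      right_inv := fun q => rfl }

theorem splitLast_apply (y : E3) : splitLast y = ((y 0, y 1), y 2) := rfl

theorem measurePreserving_splitLast : MeasurePreserving splitLast volume volume := by
  have h1 : MeasurePreserving (WithLp.ofLp : E3 → Fin 3 → ℝ) volume volume :=
    PiLp.volume_preserving_ofLp (Fin 3)
  have h2 := volume_preserving_piFinSuccAbove (fun _ : Fin 3 => ℝ) 2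
  have h3 : MeasurePreserving (Prod.map id MeasurableEquiv.finTwoArrow :
      ℝ × (Fin 2 → ℝ) → ℝ × (ℝ × ℝ)) volume volume :=
    (MeasurePreserving.id volume).prod (volume_preserving_finTwoArrow ℝ)
  have h4 : MeasurePreserving (Prod.swap : ℝ × (ℝ × ℝ) → (ℝ × ℝ) × ℝ) volume volume :=
    Measure.measurePreserving_swap
  exact h4.comp (h3.comp (h2.comp h1))

theorem det_comp_splitLast (A : (ℝ × ℝ) × ℝ →L[ℝ] E3) :
    (A ∘L (splitLast : E3 →L[ℝ] (ℝ × ℝ) × ℝ)).det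
      = det3 (A ((1, 0), 0)) (A ((0, 1), 0)) (A ((0, 0), 1)) := by
  let b := (EuclideanSpace.basisFun (Fin 3) ℝ).toBasis
  rw [ContinuousLinearMap.det, ← LinearMap.det_toMatrix b, ← Matrix.det_transpose, det3]
  congr 1
  have hb : ∀ i, b i = EuclideanSpace.single i (1 : ℝ) := fun i => by simp [b]
  have hr : ∀ (v : E3) i, b.repr v i = v i := fun v i => by simp [b]
  ext i j
  rw [Matrix.transpose_apply, LinearMap.toMatrix_apply, hb, hr]
  fin_cases i <;> fin_cases j <;> simp [splitLast_apply]

theorem IsLocalParam.measurableSet_inter_preimage (h : IsLocalParam M U φ) {E : Set E3}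
    (hE : MeasurableSet E) : MeasurableSet (U ∩ φ ⁻¹' E) := by
  have h1 := h.isOpen.measurableSet.subtype_image (h.isEmbedding.continuous.measurable hE)
  convert h1 using 1
  ext y
  simp [and_comm]

/-- The density of the area measure in a local parametrization. -/
def areaDensity (η : E3 → E3) (φ : ℝ × ℝ → E3) (x : ℝ × ℝ) : ℝ :=
  |areaForm η (φ x) (fderiv ℝ φ x (1, 0)) (fderiv ℝ φ x (0, 1))|

theorem IsBirkhoffGaussMap.continuousOn_areaDensity (hη : IsBirkhoffGaussMap N M η)
    (h : IsLocalParam M U φ) : ContinuousOn (areaDensity η φ) U :=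
  ((h.continuousOn_fderiv (1, 0)).det3 (h.continuousOn_fderiv (0, 1))
    (hη.continuousOn_comp h)).abs

theorem IsLocalParam.aemeasurable (h : IsLocalParam M U φ) :
    AEMeasurable φ (volume.restrict U) :=
  h.contDiffOn.continuousOn.aemeasurable h.isOpen.measurableSet

theorem patchMeasure_eq (η : E3 → E3) (U : Set (ℝ × ℝ)) (φ : ℝ × ℝ → E3) :
    patchMeasure η U φ = ((volume.restrict U).withDensity
      fun x => ENNReal.ofReal (areaDensity η φ x)).map φ := rfl

theorem IsLocalParam.aemeasurable_withDensity (h : IsLocalParam M U φ) :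
    AEMeasurable φ ((volume.restrict U).withDensity
      fun x => ENNReal.ofReal (areaDensity η φ x)) :=
  h.aemeasurable.mono' (withDensity_absolutelyContinuous _ _)

theorem IsBirkhoffGaussMap.setLIntegral_patchMeasure (hη : IsBirkhoffGaussMap N M η)
    (h : IsLocalParam M U φ) {E : Set E3} (hE : MeasurableSet E) {f : E3 → ENNReal}
    (hf : AEMeasurable f ((patchMeasure η U φ).restrict E)) :
    ∫⁻ p in E, f p ∂patchMeasure η U φ
      = ∫⁻ x in U ∩ φ ⁻¹' E, ENNReal.ofReal (areaDensity η φ x) * f (φ x) := by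
  have hU := h.isOpen.measurableSet
  have hφ := h.aemeasurable_withDensity (η := η)
  have hd : AEMeasurable (fun x => ENNReal.ofReal (areaDensity η φ x)) (volume.restrict U) :=
    ((hη.continuousOn_areaDensity h).aemeasurable hU).ennreal_ofReal
  have hf' : AEMeasurable (E.indicator f) (((volume.restrict U).withDensity
      fun x => ENNReal.ofReal (areaDensity η φ x)).map φ) := (aemeasurable_indicator_iff hE).2 hf
  rw [← lintegral_indicator hE, patchMeasure_eq, lintegral_map' hf' hφ,
    lintegral_withDensity_eq_lintegral_mul₀' (g := fun x => E.indicator f (φ x)) hd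
      (hf'.comp_aemeasurable hφ), ← lintegral_indicator hU,
    ← lintegral_indicator (h.measurableSet_inter_preimage hE)]
  refine lintegral_congr fun y => ?_
  by_cases hyU : y ∈ U <;> by_cases hyE : φ y ∈ E <;> simp [hyU, hyE]

theorem IsLocalParam.measurableSet_image (h : IsLocalParam M U φ) (hM : MeasurableSet M) :
    MeasurableSet (φ '' U) := by
  obtain ⟨W, hWo, hW⟩ := h.image_eq
  rw [hW]
  exact hM.inter hWo.measurableSet

theorem IsLocalParam.patchMeasure_compl (h : IsLocalParam M U φ) (hM : MeasurableSet M) :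
    patchMeasure η U φ (φ '' U)ᶜ = 0 := by
  rw [patchMeasure_eq, Measure.map_apply_of_aemeasurable h.aemeasurable_withDensity
    (h.measurableSet_image hM).compl]
  refine withDensity_absolutelyContinuous _ _ ?_
  rw [Measure.restrict_apply₀' h.isOpen.measurableSet.nullMeasurableSet]
  convert measure_empty (μ := (volume : Measure (ℝ × ℝ)))
  ext y
  simp only [mem_inter_iff, mem_preimage, mem_compl_iff, mem_empty_iff_false, iff_false, not_and]
  exact fun hy hyU => hy (mem_image_of_mem φ hyU)

/-- The density of the volume of the two-sided tube with respect to the area. -/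
def tubeDensity (M : Set E3) (η : E3 → E3) (t : ℝ) (p : E3) : ℝ :=
  2 * t + 2 * t ^ 3 / 3 * gaussCurvature M η p

theorem integral_steiner (t H K : ℝ) :
    ∫ s in (-t)..t, (1 + s * H + s ^ 2 * K) = 2 * t + 2 * t ^ 3 / 3 * K := by
  have h : ∀ s : ℝ, HasDerivAt (fun s => s + s ^ 2 / 2 * H + s ^ 3 / 3 * K)
      (1 + s * H + s ^ 2 * K) s := fun s => by
    have := ((hasDerivAt_id s).add ((((hasDerivAt_id s).pow 2).div_const 2).mul_const H)).add
      ((((hasDerivAt_id s).pow 3).div_const 3).mul_const K)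
    refine this.congr_deriv ?_
    simp
  rw [intervalIntegral.integral_eq_sub_of_hasDerivAt (fun s _ => h s)
    (Continuous.intervalIntegrable (by fun_prop) _ _)]
  ring

/-- The data for which the tubes are embedded. -/
structure IsTubeRadius (M : Set E3) (η : E3 → E3) (δ : ℝ) : Prop where
  pos : 0 < δ
  injOn : InjOn (normalMap η) (M ×ˢ Ioo (-δ) δ)
  steiner_pos : ∀ p ∈ M, ∀ t, |t| < δ →
    0 < 1 + t * traceDifferential M η p + t ^ 2 * gaussCurvature M η p

theorem IsBirkhoffGaussMap.exists_isTubeRadius (hN : IsAdmissibleNorm N)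
    (hη : IsBirkhoffGaussMap N M η) (hM : IsSurface M) (hMc : IsCompact M) :
    ∃ δ, IsTubeRadius M η δ := by
  obtain ⟨δ₁, h₁, hi⟩ := hη.exists_injOn_normalMap hN hM hMc
  obtain ⟨δ₂, h₂, hp⟩ := hη.exists_steiner_pos hN hM hMc
  refine ⟨min δ₁ δ₂, lt_min h₁ h₂, hi.mono (prod_mono subset_rfl (Ioo_subset_Ioo ?_ ?_)),
    fun p hpM t ht => hp p hpM t (ht.trans_le (min_le_right _ _))⟩
  · exact neg_le_neg (min_le_left _ _)
  · exact min_le_left _ _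

theorem IsTubeRadius.lintegral_steiner {δ t : ℝ} (hδ : IsTubeRadius M η δ) (ht : 0 < t)
    (htδ : t < δ) {p : E3} (hp : p ∈ M) :
    0 ≤ tubeDensity M η t p ∧
    ∫⁻ s in Icc (-t) t, ENNReal.ofReal
      (1 + s * traceDifferential M η p + s ^ 2 * gaussCurvature M η p)
      = ENNReal.ofReal (tubeDensity M η t p) := by
  have hle : -t ≤ t := by linarith
  have hpos : ∀ s ∈ Icc (-t) t,
      0 ≤ 1 + s * traceDifferential M η p + s ^ 2 * gaussCurvature M η p := fun s hs =>
    (hδ.steiner_pos p hp s ((abs_le.2 hs).trans_lt htδ)).le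
  have hint : IntegrableOn (fun s : ℝ =>
      1 + s * traceDifferential M η p + s ^ 2 * gaussCurvature M η p) (Icc (-t) t) :=
    Continuous.integrableOn_Icc (by fun_prop)
  have hval : ∫ s in Icc (-t) t, (1 + s * traceDifferential M η p + s ^ 2 * gaussCurvature M η p)
      = tubeDensity M η t p := by
    rw [integral_Icc_eq_integral_Ioc, ← intervalIntegral.integral_of_le hle, integral_steiner,
      tubeDensity]
  refine ⟨?_, ?_⟩
  · rw [← hval]
    exact setIntegral_nonneg measurableSet_Icc hpos
  · rw [← hval, ofReal_integral_eq_lintegral_ofReal hint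
      ((ae_restrict_iff' measurableSet_Icc).2 (Filter.Eventually.of_forall hpos))]

theorem Icc_subset_Ioo_neg {δ t : ℝ} (h : t < δ) : Icc (-t) t ⊆ Ioo (-δ) δ :=
  fun _ hs => ⟨(neg_lt_neg h).trans_le hs.1, hs.2.trans_lt h⟩

/-- The volume of the part of the tube over a subset of a coordinate patch. -/
theorem IsTubeRadius.volume_image_normalMap (hN : IsAdmissibleNorm N)
    (hη : IsBirkhoffGaussMap N M η) (hM : IsSurface M) {δ t : ℝ} (hδ : IsTubeRadius M η δ)
    (ht : 0 < t) (htδ : t < δ) (h : IsLocalParam M U φ) {E : Set E3} (hE : MeasurableSet E)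
    (hEU : E ⊆ φ '' U) :
    volume (normalMap η '' (E ×ˢ Icc (-t) t))
      = ∫⁻ p in E, ENNReal.ofReal (tubeDensity M η t p) ∂patchMeasure η U φ := by
  have hEM : E ⊆ M := hEU.trans h.mapsTo.image_subset
  set B := U ∩ φ ⁻¹' E with hB
  have hBm : MeasurableSet B := h.measurableSet_inter_preimage hE
  set S : Set E3 := splitLast ⁻¹' (B ×ˢ Icc (-t) t) with hS
  have hSm : MeasurableSet S :=
    splitLast.continuous.measurable (hBm.prod measurableSet_Icc)
  set G : E3 → E3 := fun y => normalMap η (φ (splitLast y).1, (splitLast y).2) with hG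
  let G' : (ℝ × ℝ) × ℝ → (ℝ × ℝ) × ℝ →L[ℝ] E3 := fun q =>
    (fderiv ℝ φ q.1 + q.2 • fderiv ℝ (η ∘ φ) q.1) ∘L ContinuousLinearMap.fst ℝ (ℝ × ℝ) ℝ +
        (ContinuousLinearMap.snd ℝ (ℝ × ℝ) ℝ).smulRight (η (φ q.1))
  have himage : normalMap η '' (E ×ˢ Icc (-t) t) = G '' S := by
    ext z
    constructor
    · rintro ⟨⟨p, s⟩, ⟨hp, hs⟩, rfl⟩
      obtain ⟨y, hy, rfl⟩ := hEU hp
      refine ⟨splitLast.symm (y, s), ?_, ?_⟩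
      · simp only [hS, mem_preimage, ContinuousLinearEquiv.apply_symm_apply]
        exact ⟨⟨hy, hp⟩, hs⟩
      · simp only [hG, ContinuousLinearEquiv.apply_symm_apply]
    · rintro ⟨y, hy, rfl⟩
      exact ⟨(φ (splitLast y).1, (splitLast y).2), ⟨hy.1.2, hy.2⟩, rfl⟩
  have hGd : ∀ y ∈ S, HasFDerivWithinAt G
      ((G' (splitLast y)) ∘L (splitLast : E3 →L[ℝ] (ℝ × ℝ) × ℝ)) S y := fun y hy => by
    have h1 : HasFDerivAt (fun q : (ℝ × ℝ) × ℝ => normalMap η (φ q.1, q.2)) (G' (splitLast y))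
        (splitLast y) :=
      (hη.hasStrictFDerivAt_normalMap hN h hy.1.1 (splitLast y).2).hasFDerivAt
    exact (h1.comp y splitLast.hasFDerivAt).hasFDerivWithinAt
  have hGi : InjOn G S := by
    intro y hy z hz hyz
    have h1 := @hδ.injOn (φ (splitLast y).1, (splitLast y).2)
      ⟨hEM hy.1.2, Icc_subset_Ioo_neg htδ hy.2⟩ (φ (splitLast z).1, (splitLast z).2)
      ⟨hEM hz.1.2, Icc_subset_Ioo_neg htδ hz.2⟩ hyz
    rw [Prod.mk.injEq] at h1
    exact splitLast.injective (Prod.ext (h.injOn hy.1.1 hz.1.1 h1.1) h1.2)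
  set J : (ℝ × ℝ) × ℝ → ENNReal := fun q =>
    ENNReal.ofReal (areaDensity η φ q.1) * ENNReal.ofReal
      (1 + q.2 * traceDifferential M η (φ q.1) + q.2 ^ 2 * gaussCurvature M η (φ q.1)) with hJ
  have hdet : ∀ y ∈ S, ENNReal.ofReal
      |((G' (splitLast y)) ∘L (splitLast : E3 →L[ℝ] (ℝ × ℝ) × ℝ)).det| = J (splitLast y) := by
    intro y hy
    have h1 := hη.det3_parallel hN h hy.1.1 (splitLast y).2
    have h2 := hδ.steiner_pos _ (hEM hy.1.2) _ ((abs_le.2 hy.2).trans_lt htδ)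
    rw [det_comp_splitLast]
    have e1 : G' (splitLast y) ((1, 0), 0) = fderiv ℝ φ (splitLast y).1 (1, 0)
      + (splitLast y).2 • fderiv ℝ (η ∘ φ) (splitLast y).1 (1, 0) := by simp [G']
    have e2 : G' (splitLast y) ((0, 1), 0) = fderiv ℝ φ (splitLast y).1 (0, 1)
      + (splitLast y).2 • fderiv ℝ (η ∘ φ) (splitLast y).1 (0, 1) := by simp [G']
    have e3 : G' (splitLast y) ((0, 0), 1) = η (φ (splitLast y).1) := by
      have : ((0, 0) : ℝ × ℝ) = 0 := rfl
      simp [G', this]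
    rw [e1, e2, e3, h1, abs_mul, abs_of_pos h2, mul_comm, ENNReal.ofReal_mul (abs_nonneg _)]
    rfl
  have hKc := hη.continuousOn_gaussCurvature_comp hN h
  have hKM := hη.continuousOn_gaussCurvature hN hM
  have hHM := hη.continuousOn_traceDifferential hN hM
  have hJm : AEMeasurable J ((volume.prod volume).restrict (B ×ˢ Icc (-t) t)) := by
    have hfst : ContinuousOn (fun q : (ℝ × ℝ) × ℝ => φ q.1) (B ×ˢ Icc (-t) t) :=
      h.contDiffOn.continuousOn.comp continuousOn_fst fun q hq => hq.1.1
    have hmaps : MapsTo (fun q : (ℝ × ℝ) × ℝ => φ q.1) (B ×ˢ Icc (-t) t) M :=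
      fun q hq => hEM hq.1.2
    have c1 : ContinuousOn (fun q : (ℝ × ℝ) × ℝ => areaDensity η φ q.1) (B ×ˢ Icc (-t) t) :=
      (hη.continuousOn_areaDensity h).comp continuousOn_fst fun q hq => hq.1.1
    have c2 : ContinuousOn (fun q : (ℝ × ℝ) × ℝ => 1 + q.2 * traceDifferential M η (φ q.1)
        + q.2 ^ 2 * gaussCurvature M η (φ q.1)) (B ×ˢ Icc (-t) t) :=
      (continuousOn_const.add (continuousOn_snd.mul (hHM.comp hfst hmaps))).add
        ((continuousOn_snd.pow 2).mul (hKM.comp hfst hmaps))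
    have hm := hBm.prod (measurableSet_Icc (a := -t) (b := t))
    exact (c1.aemeasurable hm).ennreal_ofReal.mul (c2.aemeasurable hm).ennreal_ofReal
  have hfm : AEMeasurable (fun p => ENNReal.ofReal (tubeDensity M η t p))
      ((patchMeasure η U φ).restrict E) := by
    have c : ContinuousOn (tubeDensity M η t) E :=
      continuousOn_const.add (continuousOn_const.mul (hKM.mono hEM))
    exact (c.aemeasurable hE).ennreal_ofReal
  rw [himage, ← lintegral_abs_det_fderiv_eq_addHaar_image volume hSm hGd hGi,
    setLIntegral_congr_fun hSm hdet, hS,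
    measurePreserving_splitLast.setLIntegral_comp_preimage_emb
      splitLast.toHomeomorph.measurableEmbedding, Measure.volume_eq_prod, setLIntegral_prod _ hJm,
    hη.setLIntegral_patchMeasure h hE hfm]
  refine setLIntegral_congr_fun hBm fun y hy => ?_
  simp only [hJ]
  rw [lintegral_const_mul' _ _ ENNReal.ofReal_ne_top,
    (hδ.lintegral_steiner ht htδ (hEM hy.2)).2]

end

section

variable {M : Set E3} {N : Seminorm ℝ E3} {η : E3 → E3}

/-- The area is determined by the volumes of the tubes of radii `t` and `2t`. -/
theorem IsTubeRadius.area_add_volume {δ t : ℝ} (hδ : IsTubeRadius M η δ) (ht : 0 < t)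
    (htδ : 2 * t < δ) {E : Set E3} (hE : MeasurableSet E) (hEM : E ⊆ M) (μ : Measure E3) :
    ENNReal.ofReal (12 * t) * μ E + ∫⁻ p in E, ENNReal.ofReal (tubeDensity M η (2 * t) p) ∂μ
      = 8 * ∫⁻ p in E, ENNReal.ofReal (tubeDensity M η t p) ∂μ := by
  rw [← setLIntegral_const, ← lintegral_add_left measurable_const,
    ← lintegral_const_mul' _ _ (by simp)]
  refine setLIntegral_congr_fun hE fun p hp => ?_
  have h1 := (hδ.lintegral_steiner (by linarith) htδ (hEM hp)).1
  rw [← ENNReal.ofReal_add (by positivity) h1, show (8 : ENNReal) = ENNReal.ofReal 8 by simp,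
    ← ENNReal.ofReal_mul (by norm_num)]
  congr 1
  simp only [tubeDensity]
  ring

theorem IsBirkhoffGaussMap.volume_image_lt_top (hη : IsBirkhoffGaussMap N M η)
    (hMc : IsCompact M) (t : ℝ) : volume (normalMap η '' (M ×ˢ Icc (-t) t)) < ⊤ :=
  ((hMc.prod isCompact_Icc).image_of_continuousOn
    (hη.continuousOn_normalMap.mono (prod_mono subset_rfl (subset_univ _)))).measure_lt_top

/-- The area measures of two coordinate patches agree on the overlap. -/
theorem IsTubeRadius.patchMeasure_apply_eq (hN : IsAdmissibleNorm N)
    (hη : IsBirkhoffGaussMap N M η) (hM : IsSurface M) (hMc : IsCompact M) {δ : ℝ}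
    (hδ : IsTubeRadius M η δ) {U U' : Set (ℝ × ℝ)} {φ φ' : ℝ × ℝ → E3} (h : IsLocalParam M U φ)
    (h' : IsLocalParam M U' φ') {E : Set E3} (hE : MeasurableSet E) (hEU : E ⊆ φ '' U)
    (hEU' : E ⊆ φ' '' U') : patchMeasure η U φ E = patchMeasure η U' φ' E := by
  have hEM : E ⊆ M := hEU.trans h.mapsTo.image_subset
  have hpos := hδ.pos
  obtain ⟨t, ht, htδ⟩ : ∃ t, 0 < t ∧ 2 * t < δ := ⟨δ / 3, by positivity, by linarith⟩
  have h1 := hδ.area_add_volume ht htδ hE hEM (patchMeasure η U φ)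
  have h2 := hδ.area_add_volume ht htδ hE hEM (patchMeasure η U' φ')
  rw [← hδ.volume_image_normalMap hN hη hM ht (by linarith) h hE hEU,
    ← hδ.volume_image_normalMap hN hη hM (by linarith) htδ h hE hEU] at h1
  rw [← hδ.volume_image_normalMap hN hη hM ht (by linarith) h' hE hEU',
    ← hδ.volume_image_normalMap hN hη hM (by linarith) htδ h' hE hEU', ← h1] at h2
  have hfin : volume (normalMap η '' (E ×ˢ Icc (-(2 * t)) (2 * t))) ≠ ⊤ :=
    ((measure_mono (image_mono (prod_mono hEM subset_rfl))).trans_lt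
      (hη.volume_image_lt_top hMc (2 * t))).ne
  rw [ENNReal.add_left_inj hfin] at h2
  exact ((ENNReal.mul_right_inj (by simpa using ht) ENNReal.ofReal_ne_top).1 h2).symm

theorem IsSurface.exists_seq_localParam (hM : IsSurface M) (hMne : M.Nonempty) :
    ∃ (U : ℕ → Set (ℝ × ℝ)) (φ : ℕ → ℝ × ℝ → E3), (∀ n, IsLocalParam M (U n) (φ n)) ∧
      ⋃ n, φ n '' U n = M := by
  choose! U φ h hp using hM
  obtain ⟨s, hsM, hsc, hs⟩ := TopologicalSpace.countable_cover_nhdsWithin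
    (f := fun p => φ p '' U p) (s := M) fun p hpM => by
      obtain ⟨x, hx, hxp⟩ := hp p hpM
      have h1 := (h p hpM).map_nhds hx
      rw [hxp] at h1
      rw [← h1]
      exact Filter.image_mem_map ((h p hpM).isOpen.mem_nhds hx)
  have hsne : s.Nonempty := by
    obtain ⟨p, hpM⟩ := hMne
    obtain ⟨q, hq, -⟩ := mem_iUnion₂.1 (hs hpM)
    exact ⟨q, hq⟩
  obtain ⟨a, rfl⟩ := hsc.exists_eq_range hsne
  refine ⟨fun n => U (a n), fun n => φ (a n), fun n => h _ (hsM (mem_range_self n)),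
    subset_antisymm (iUnion_subset fun n => (h _ (hsM (mem_range_self n))).mapsTo.image_subset) ?_⟩
  rwa [biUnion_range] at hs

/-- The surface decomposes into countably many measurable pieces, each in a coordinate patch, and
on each of them the area measure is the patch measure. -/
theorem IsTubeRadius.areaMeasure_eq_sum (hN : IsAdmissibleNorm N)
    (hη : IsBirkhoffGaussMap N M η) (hM : IsSurface M) (hMc : IsCompact M) (hMne : M.Nonempty)
    {δ : ℝ} (hδ : IsTubeRadius M η δ) :
    ∃ (U : ℕ → Set (ℝ × ℝ)) (φ : ℕ → ℝ × ℝ → E3) (A : ℕ → Set E3),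
      (∀ n, IsLocalParam M (U n) (φ n)) ∧ (∀ n, MeasurableSet (A n)) ∧ (∀ n, A n ⊆ φ n '' U n) ∧
      Pairwise (Function.onFun Disjoint A) ∧ ⋃ n, A n = M ∧
      areaMeasure M η = Measure.sum fun n => (patchMeasure η (U n) (φ n)).restrict (A n) := by
  have hMm : MeasurableSet M := hMc.measurableSet
  obtain ⟨U, φ, h, hcover⟩ := hM.exists_seq_localParam hMne
  set A := disjointed fun n => φ n '' U n with hA
  have hAm : ∀ n, MeasurableSet (A n) :=
    fun n => MeasurableSet.disjointed (fun n => (h n).measurableSet_image hMm) n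
  have hAU : ∀ n, A n ⊆ φ n '' U n := fun n => disjointed_subset _ n
  have hAd : Pairwise (Function.onFun Disjoint A) := disjoint_disjointed _
  have hAM : ⋃ n, A n = M := by rw [hA, iUnion_disjointed, hcover]
  refine ⟨U, φ, A, h, hAm, hAU, hAd, hAM, le_antisymm (sSup_le ?_) ?_⟩
  · rintro _ ⟨V, ψ, hψ, rfl⟩
    refine Measure.le_iff.2 fun E hE => ?_
    have hV := hψ.measurableSet_image hMm
    have e1 : patchMeasure η V ψ E = patchMeasure η V ψ (E ∩ ψ '' V) := by
      exact (measure_inter_conull (hψ.patchMeasure_compl hMm)).symm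
    have e2 : E ∩ ψ '' V = ⋃ n, (E ∩ ψ '' V) ∩ A n := by
      rw [← inter_iUnion, hAM, eq_comm, inter_eq_left]
      exact inter_subset_right.trans hψ.mapsTo.image_subset
    rw [e1, e2, measure_iUnion (fun i j hij => (hAd hij).mono inter_subset_right inter_subset_right)
      fun n => (hE.inter hV).inter (hAm n), Measure.sum_apply _ hE]
    refine ENNReal.tsum_le_tsum fun n => ?_
    rw [Measure.restrict_apply hE, hδ.patchMeasure_apply_eq hN hη hM hMc hψ (h n)
      ((hE.inter hV).inter (hAm n)) (inter_subset_left.trans inter_subset_right)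
      (inter_subset_right.trans (hAU n))]
    exact measure_mono (inter_subset_inter_left _ inter_subset_left)
  · refine Measure.le_iff.2 fun E hE => ?_
    rw [Measure.sum_apply _ hE]
    calc ∑' n, (patchMeasure η (U n) (φ n)).restrict (A n) E
        ≤ ∑' n, areaMeasure M η (E ∩ A n) := by
          refine ENNReal.tsum_le_tsum fun n => ?_
          rw [Measure.restrict_apply hE]
          exact (le_sSup ⟨U n, φ n, h n, rfl⟩ : _ ≤ areaMeasure M η) _
      _ = areaMeasure M η (⋃ n, E ∩ A n) :=
          (measure_iUnion (fun i j hij => (hAd hij).mono inter_subset_right inter_subset_right)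
            fun n => hE.inter (hAm n)).symm
      _ ≤ areaMeasure M η E := measure_mono (iUnion_subset fun n => inter_subset_left)

/-- The volume of the swept-out tube, as an integral over the surface. -/
theorem IsTubeRadius.volume_image_eq_lintegral (hN : IsAdmissibleNorm N)
    (hη : IsBirkhoffGaussMap N M η) (hM : IsSurface M) (hMc : IsCompact M) (hMne : M.Nonempty)
    {δ t : ℝ} (hδ : IsTubeRadius M η δ) (ht : 0 < t) (htδ : t < δ) :
    volume (normalMap η '' (M ×ˢ Icc (-t) t))
      = ∫⁻ p in M, ENNReal.ofReal (tubeDensity M η t p) ∂areaMeasure M η := by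
  obtain ⟨U, φ, A, h, hAm, hAU, hAd, hAM, hsum⟩ := hδ.areaMeasure_eq_sum hN hη hM hMc hMne
  have hsub : ∀ n, A n ⊆ M := fun n => hAM ▸ subset_iUnion A n
  have hcont : ContinuousOn (normalMap η) (M ×ˢ Icc (-t) t) :=
    hη.continuousOn_normalMap.mono (prod_mono subset_rfl (subset_univ _))
  have hinj : InjOn (normalMap η) (M ×ˢ Icc (-t) t) :=
    hδ.injOn.mono (prod_mono subset_rfl (Icc_subset_Ioo_neg htδ))
  have hsubp : ∀ n, A n ×ˢ Icc (-t) t ⊆ M ×ˢ Icc (-t) t := fun n =>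
    prod_mono (hsub n) subset_rfl
  rw [hsum, Measure.restrict_sum _ hMc.measurableSet, lintegral_sum_measure]
  conv_lhs => rw [← hAM, iUnion_prod_const, image_iUnion]
  rw [measure_iUnion]
  · refine tsum_congr fun n => ?_
    rw [Measure.restrict_restrict hMc.measurableSet, inter_eq_right.2 (hsub n),
      hδ.volume_image_normalMap hN hη hM ht htδ (h n) (hAm n) (hAU n)]
  · intro i j hij
    refine disjoint_left.2 ?_
    rintro _ ⟨q, hq, rfl⟩ ⟨q', hq', hqq⟩
    have := hinj (hsubp j hq') (hsubp i hq) hqq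
    subst this
    exact disjoint_left.1 (hAd hij) hq.1 hq'.1
  · exact fun n => ((hAm n).prod measurableSet_Icc).image_of_continuousOn_injOn
      (hcont.mono (hsubp n)) (hinj.mono (hsubp n))

theorem IsTubeRadius.areaMeasure_lt_top (hN : IsAdmissibleNorm N)
    (hη : IsBirkhoffGaussMap N M η) (hM : IsSurface M) (hMc : IsCompact M) (hMne : M.Nonempty)
    {δ : ℝ} (hδ : IsTubeRadius M η δ) : areaMeasure M η M < ⊤ := by
  have hpos := hδ.pos
  obtain ⟨t, ht, htδ⟩ : ∃ t, 0 < t ∧ 2 * t < δ := ⟨δ / 3, by positivity, by linarith⟩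
  have h1 := hδ.area_add_volume ht htδ hMc.measurableSet subset_rfl (areaMeasure M η)
  rw [← hδ.volume_image_eq_lintegral hN hη hM hMc hMne ht (by linarith)] at h1
  have h2 : ENNReal.ofReal (12 * t) * areaMeasure M η M < ⊤ := by
    refine (le_self_add.trans h1.le).trans_lt ?_
    exact ENNReal.mul_lt_top (by simp) (hη.volume_image_lt_top hMc t)
  exact ENNReal.lt_top_of_mul_ne_top_right h2.ne (by simpa using ht)

theorem IsBirkhoffGaussMap.integrableOn_gaussCurvature (hN : IsAdmissibleNorm N)
    (hη : IsBirkhoffGaussMap N M η) (hM : IsSurface M) (hMc : IsCompact M)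
    (hfin : areaMeasure M η M < ⊤) :
    IntegrableOn (gaussCurvature M η) M (areaMeasure M η) := by
  have hc := hη.continuousOn_gaussCurvature hN hM
  obtain ⟨B, hB⟩ := hMc.exists_bound_of_continuousOn hc
  exact ⟨hc.aestronglyMeasurable hMc.measurableSet, .restrict_of_bounded (C := B) hfin
    ((ae_restrict_iff' hMc.measurableSet).2 (Filter.Eventually.of_forall hB))⟩

end

end Minkowski

end

theorem theorem3p1 (N : Seminorm ℝ Minkowski.E3) (hN : Minkowski.IsAdmissibleNorm N)
    (M : Set Minkowski.E3) (hM : Minkowski.IsSurface M) (hMc : IsCompact M) (hMne : M.Nonempty)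
    (η : Minkowski.E3 → Minkowski.E3) (hη : Minkowski.IsBirkhoffGaussMap N M η) :
    Minkowski.areaMeasure M η M < ⊤ ∧
    IntegrableOn (Minkowski.gaussCurvature M η) M (Minkowski.areaMeasure M η) ∧
    ∃ ε₀ : ℝ, 0 < ε₀ ∧ ∀ ε : ℝ, 0 < ε → ε < ε₀ →
      volume (Minkowski.tube N M ε) < ⊤ ∧
      (volume (Minkowski.tube N M ε)).toReal =
        2 * ε * (Minkowski.areaMeasure M η M).toReal +
          2 * ε ^ 3 / 3 *
            ∫ p in M, Minkowski.gaussCurvature M η p ∂(Minkowski.areaMeasure M η) := by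
  obtain ⟨δ, hδ⟩ := hη.exists_isTubeRadius hN hM hMc
  have hfin := hδ.areaMeasure_lt_top hN hη hM hMc hMne
  have hint := hη.integrableOn_gaussCurvature hN hM hMc hfin
  refine ⟨hfin, hint, δ, hδ.pos, fun ε hε hεδ => ?_⟩
  rw [Minkowski.tube_eq_image hN hM hMc hMne hη hε.le]
  refine ⟨hη.volume_image_lt_top hMc ε, ?_⟩
  have hconst : IntegrableOn (fun _ : Minkowski.E3 => 2 * ε) M (Minkowski.areaMeasure M η) :=
    integrableOn_const hfin.ne
  have hdens : IntegrableOn (Minkowski.tubeDensity M η ε) M (Minkowski.areaMeasure M η) :=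
    hconst.add (hint.const_mul (2 * ε ^ 3 / 3))
  have hnonneg : ∀ p ∈ M, 0 ≤ Minkowski.tubeDensity M η ε p := fun p hp =>
    (hδ.lintegral_steiner hε hεδ hp).1
  rw [hδ.volume_image_eq_lintegral hN hη hM hMc hMne hε hεδ,
    ← ofReal_integral_eq_lintegral_ofReal hdens
      ((ae_restrict_iff' hMc.measurableSet).2 (Filter.Eventually.of_forall hnonneg)),
    ENNReal.toReal_ofReal (setIntegral_nonneg hMc.measurableSet hnonneg)]
  simp only [Minkowski.tubeDensity]
  rw [integral_add hconst (hint.const_mul _), setIntegral_const, integral_const_mul,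
    Measure.real, smul_eq_mul]
  ring
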